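/- For $u,v\in\{0,1\}^n$ let $d(u,v)=\frac1n|\{i:u_i\ne v_i\}|$. For distributions over $\{0,1\}^n$ let $d(P,Q)$ be the earth mover's distance, i.e. the minimum of $\mathrm E_{(u,v)\sim T}[d(u,v)]$ over all couplings $T$ of $P$ and $Q$. Let $\mathcal S_m$ be the set of distributions supported on at most $m$ elements; $P$ is *$\varepsilon$-far* from $\mathcal S_m$ if $\min_{Q\in\mathcal S_m}d(P,Q)>\varepsilon$. Call reals $\delta,\zeta>0$ and $\eta>1$ *secret-sharing constants* if for every integer $k\ge1$ there are integers $m\ge 2k$ with $3\mid m$ and $n\le\eta\log_2 m$, and two disjoint sets $\mathcal H(0),\mathcal H(1)\subseteq\{0,1\}^n$ of size $\frac23m$ each, such that (i) $d(u,v)>\delta$ for all distinct $u,v\in\mathcal H(0)\cup\mathcal H(1)$, and (ii) for every $I\subseteq\{1,\dots,n\}$ with $|I|\le\zeta n$ and every $w\in\{0,1\}^I$, $\Pr_{u\sim\mathcal H(0)}[u|_I=w]=\Pr_{u\sim\mathcal H(1)}[u|_I=w]$, where $u$ is uniform. An adaptive algorithm with $s$ samples is a (distribution over) decision tree(s) whose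 internal nodes query bit $j$ of the $i$-th of $s$ independent samples $x_1,\dots,x_s\sim P$; its number of queries is the maximal height of a tree. If $Q$ is the set of queries made in a run, the contradiction graph has vertices $1,\dots,s$ and an edge $\{a,b\}$ whenever $(x_a)_j\ne(x_b)_j$ for some $j$ with $(a,j),(b,j)\in Q$. For $P$ supported on more than $m$ elements, the run finds a *witness against $P\in\mathcal S_m$* if this graph is not $m$-colorable. **Theorem.** Secret-sharing constants exist. Moreover, let $\delta,\zeta,\eta$ be any secret-sharing constants. For every $k\ge1$ there exist integers $m\ge 2k$ and $n\le\eta\log_2 m$ such that for every $0<\varepsilon<\frac14\delta$ there is a distribution $P$ over $\{0,1\}^n$ that is $\varepsilon$-far from $\mathcal S_m$ and for which every (possibly randomized) adaptive algorithm, with any number of samples, that makes fewer than $\frac1{96}\zeta\delta\varepsilon^{-1}m\log_2 m$ queries finds a witness against $P\in\mathcal S_m$ with probability less than $\frac13$. -/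

import Mathlib

open scoped ENNReal

/-- Binary strings of length `n`. -/
abbrev BitStr (n : ℕ) : Type := Fin n → Bool

/-- Normalized Hamming distance of two strings. -/
noncomputable def strDist {n : ℕ} (u v : BitStr n) : ℝ := (hammingDist u v : ℝ) / n

/-- Transfer distributions from `P` to `Q`: joint distributions with marginals `P` and `Q`. -/
def transferDistributions {n : ℕ} (P Q : PMF (BitStr n)) : Set (PMF (BitStr n × BitStr n)) :=
  {T | T.map Prod.fst = P ∧ T.map Prod.snd = Q}

/-- Earth mover's distance with respect to the normalized Hamming distance. -/
noncomputable def emd {n : ℕ} (P Q : PMF (BitStr n)) : ℝ≥0∞ :=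
  ⨅ T ∈ transferDistributions P Q,
    ∑ p : BitStr n × BitStr n, T p * ENNReal.ofReal (strDist p.1 p.2)

/-- The property of distributions over `{0,1}^n` that are supported by at most `m` elements. -/
def boundedSupport (n m : ℕ) : Set (PMF (BitStr n)) := {Q | Q.support.ncard ≤ m}

/-- `P` is `ε`-far from a property: its earth mover's distance from it exceeds `ε`. -/
def IsFar {n : ℕ} (ε : ℝ) (P : PMF (BitStr n)) (S : Set (PMF (BitStr n))) : Prop :=
  ENNReal.ofReal ε < ⨅ Q ∈ S, emd P Q

open Classical in
/-- The probability that a uniformly random element `u` of `C` satisfies `u|_I = w`. -/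
noncomputable def restrictionProb {n : ℕ} (C : Finset (BitStr n)) (I : Finset (Fin n))
    (w : I → Bool) : ℝ :=
  ((C.filter fun u => ∀ i : I, u i = w i).card : ℝ) / C.card

/-- A secret-sharing code ensemble `H : {0,1} → 𝒫({0,1}^n)` with parameters `δ`, `ζ`, `m`
(`false` and `true` stand for the bits `0` and `1`). -/
structure IsSecretSharingEnsemble (δ ζ : ℝ) (m n : ℕ) (H : Bool → Finset (BitStr n)) :
    Prop where
  /-- `|H(b)| = 2m/3`. -/
  card_eq : ∀ b, ((H b).card : ℝ) = 2 / 3 * (m : ℝ)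
  disjoint : Disjoint (H false) (H true)
  dist_lt : ∀ u ∈ H false ∪ H true, ∀ v ∈ H false ∪ H true, u = v ∨ δ < strDist u v
  shared_secret : ∀ I : Finset (Fin n), (I.card : ℝ) ≤ ζ * n → ∀ w : I → Bool,
    restrictionProb (H false) I w = restrictionProb (H true) I w

/-- The constants `δ`, `ζ`, `η` admit secret-sharing code ensembles of arbitrarily large size. -/
structure AreSecretSharingConstants (δ ζ η : ℝ) : Prop where
  delta_pos : 0 < δ
  zeta_pos : 0 < ζ
  one_lt_eta : 1 < η
  exists_ensemble : ∀ k : ℕ, 1 ≤ k → ∃ m n : ℕ, 2 * k ≤ m ∧ 3 ∣ m ∧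
    (n : ℝ) ≤ η * Real.logb 2 m ∧
    ∃ H : Bool → Finset (BitStr n), IsSecretSharingEnsemble δ ζ m n H

/-- The contradiction graph of the samples `x` with the query set `Q`: two samples are adjacent
when they are both queried at a common index, with different answers. -/
def contradictionGraph {s n : ℕ} (x : Fin s → BitStr n) (Q : Finset (Fin s × Fin n)) :
    SimpleGraph (Fin s) where
  Adj a b := ∃ j : Fin n, x a j ≠ x b j ∧ (a, j) ∈ Q ∧ (b, j) ∈ Q
  symm := ⟨fun _ _ ⟨j, h, ha, hb⟩ => ⟨j, h.symm, hb, ha⟩⟩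
  loopless := ⟨fun _ ⟨_, h, _⟩ => h rfl⟩

/-- `(x; Q)` is a witness against `m`-support of `P`. -/
def IsWitness {s n : ℕ} (P : PMF (BitStr n)) (m : ℕ) (x : Fin s → BitStr n)
    (Q : Finset (Fin s × Fin n)) : Prop :=
  m < P.support.ncard ∧ (∀ i, x i ∈ P.support) ∧ ¬ (contradictionGraph x Q).Colorable m

/-- A deterministic adaptive algorithm with `s` samples from `{0,1}^n`: a decision tree whose
internal nodes query a bit `j` of a sample `i`, and whose leaves accept or reject. -/
inductive DecisionTree (s n : ℕ) : Type
  | leaf (accept : Bool) : DecisionTree s n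
  | query (i : Fin s) (j : Fin n) (next : Bool → DecisionTree s n) : DecisionTree s n

namespace DecisionTree

/-- The height of the tree, that is, the number of queries. -/
def height {s n : ℕ} : DecisionTree s n → ℕ
  | leaf _ => 0
  | query _ _ next => 1 + max (height (next false)) (height (next true))

/-- The set of queries that are made when the samples are `x`. -/
def queries {s n : ℕ} (x : Fin s → BitStr n) : DecisionTree s n → Finset (Fin s × Fin n)
  | leaf _ => ∅
  | query i j next => insert (i, j) (queries x (next (x i j)))

open Classical in
/-- The probability that the tree, run on `s` independent samples from `P`, finds a witness
against `m`-support of `P`. -/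
noncomputable def witnessProb {s n : ℕ} (T : DecisionTree s n) (P : PMF (BitStr n)) (m : ℕ) :
    ℝ≥0∞ :=
  ∑ x : Fin s → BitStr n, if IsWitness P m x (T.queries x) then ∏ i, P (x i) else 0

end DecisionTree

/-- A probabilistic adaptive algorithm: a distribution over deterministic ones. (The type of
decision trees is countable, so every distribution over it is discrete.) -/
abbrev AdaptiveAlgorithm (s n : ℕ) : Type := PMF (DecisionTree s n)

namespace AdaptiveAlgorithm

/-- The algorithm always makes fewer than `b` queries. -/
def MakesFewerQueriesThan {s n : ℕ} (A : AdaptiveAlgorithm s n) (b : ℝ) : Prop :=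
  ∀ T ∈ PMF.support A, (T.height : ℝ) < b

/-- The probability, over its coins and over `s` independent samples from `P`, that the algorithm
finds a witness against `m`-support of `P`. -/
noncomputable def witnessProb {s n : ℕ} (A : AdaptiveAlgorithm s n) (P : PMF (BitStr n))
    (m : ℕ) : ℝ≥0∞ :=
  ∑' T : DecisionTree s n, (A : PMF (DecisionTree s n)) T * T.witnessProb P m

end AdaptiveAlgorithm

/-! Secret-sharing codes come from a random binary matrix with `24 * a + 1` rows and `48 * a`
columns. A union bound shows that, for some choice, every nonzero combination of the rows has weight
above `a`, while no nonzero vector of weight at most `a` is orthogonal to all rows but the last.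
`H(0)` is the span of all rows but the last, and `H(1)` its translate by the last row. The dual
distance makes the span restrict onto every set `I` of at most `a` indices surjectively; hence some
codeword agrees with the last row on `I`, and subtracting it maps `H(0)` bijectively to `H(1)`
without changing what is seen on `I`.

For the lower bound with `ε < δ / 16`, `P` puts mass `μ = 8 * ε / δ` on `H(1)` and the rest on
`H(0)`. Any `m` strings are within `δ / 2` of at most `m` of the `4 * m / 3` codewords, so the
codewords left over carry enough mass to make `P` far. A sample from `H(1)` that receives at most `ζ
* n` queries looks like some word of `H(0)`, so `2 * m / 3` colors serve all samples except the
heavily queried ones from `H(1)`; a witness needs more than `m / 3` of the latter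
(`card_lt_of_isWitness`). By secret sharing, being heavily queried is independent of the side a
sample comes from (`sum_many_queries_eq`), so only a fraction `μ` of the heavy queries is useful on
average, and Markov's inequality finishes.

For larger `ε` the mixture would need `μ > 1 / 2`, and the uniform distribution takes over. It is
far by sphere packing (`isFar_uniformOfFintype`), and with at most `m * log₂ m / 6` queries no
witness exists at all: `m / 3` colors go to the samples with many queries, and by the probabilistic
method `2 * m / 3` strings agree with all the others (`contradictionGraph_colorable_of_card_le`). -/

/-! ### Existence of secret-sharing codes -/

/-- A Chernoff-type bound for the volume of a Hamming ball of radius `a` in dimension `48 a`. -/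
theorem card_hammingNorm_le (a : ℕ) :
    (Finset.univ.filter fun u : Fin (48 * a) → ZMod 2 => hammingNorm u ≤ a).card ≤ 2 ^ (12 * a) := by
  set B := Finset.univ.filter fun u : Fin (48 * a) → ZMod 2 => hammingNorm u ≤ a with hB
  -- Weight every string by 8 to the number of its zeros: the total is `9 ^ (48 * a)`, and each
  -- string in the ball weighs at least `8 ^ (47 * a)`.
  have h1 : (9 : ℕ) ^ (48 * a)
      = ∑ u : Fin (48 * a) → ZMod 2, ∏ i, (if u i = 0 then 8 else 1) := by
    have := Fintype.sum_pow (fun b : ZMod 2 => if b = 0 then (8 : ℕ) else 1) (48 * a)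
    rw [← this]
    congr 1
  have h2 : B.card * 8 ^ (47 * a) ≤ 9 ^ (48 * a) := by
    rw [h1, ← smul_eq_mul, ← Finset.sum_const]
    refine (Finset.sum_le_sum fun u hu => ?_).trans
      (Finset.sum_le_sum_of_subset (Finset.filter_subset _ _))
    rw [Finset.prod_ite, Finset.prod_const, Finset.prod_const_one, mul_one]
    refine Nat.pow_le_pow_right (by norm_num) ?_
    have hu' : hammingNorm u ≤ a := (Finset.mem_filter.1 hu).2
    have h3 := Finset.card_filter_add_card_filter_not
      (s := (Finset.univ : Finset (Fin (48 * a)))) (fun i => u i = 0)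
    have h4 : hammingNorm u = (Finset.univ.filter fun i => ¬ u i = 0).card := rfl
    rw [Finset.card_univ, Fintype.card_fin] at h3
    omega
  have h3 : (9 : ℕ) ^ (48 * a) ≤ 2 ^ (12 * a) * 8 ^ (47 * a) := by
    rw [pow_mul, pow_mul, pow_mul, ← mul_pow]
    exact Nat.pow_le_pow_left (by norm_num) _
  exact Nat.le_of_mul_le_mul_right (h2.trans h3) (by positivity)

/-- A surjective homomorphism of finite groups is equidistributed. -/
theorem card_preimage_mul_card {A B : Type*} [AddCommGroup A] [AddCommGroup B] [Fintype A]
    [Fintype B] [DecidableEq B] (f : A →+ B) (hf : Function.Surjective f) (S : Finset B) :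
    (Finset.univ.filter fun a => f a ∈ S).card * Fintype.card B = S.card * Fintype.card A := by
  have hfib : ∀ b, (Finset.univ.filter fun a => f a = b).card
      = (Finset.univ.filter fun a => f a = 0).card := fun b =>
    AddMonoidHom.card_fiber_eq_of_mem_range f (hf b) (hf 0)
  have key : ∀ S : Finset B, (Finset.univ.filter fun a => f a ∈ S).card
      = S.card * (Finset.univ.filter fun a => f a = 0).card := by
    intro S
    rw [Finset.card_eq_sum_card_fiberwise (f := f) (t := S) (by intro a ha; simpa using ha),
      ← smul_eq_mul, ← Finset.sum_const]
    refine Finset.sum_congr rfl fun b hb => ?_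
    rw [← hfib b, Finset.filter_filter]
    congr 1
    ext a
    simp only [Finset.mem_filter, Finset.mem_univ, true_and]
    exact ⟨fun h => h.2, fun h => ⟨h ▸ hb, h⟩⟩
  have h1 := key Finset.univ
  simp only [Finset.mem_univ, Finset.filter_true, Finset.card_univ] at h1
  rw [key S, h1]
  ring

/-- One row of `G` at a nonzero coordinate of `x` suffices. Hence `x G` is uniform when `G` is,
which the union bound over matrices needs. -/
theorem vecMul_surjective_left {t n : ℕ} {x : Fin t → ZMod 2} (hx : x ≠ 0) :
    Function.Surjective fun G : Matrix (Fin t) (Fin n) (ZMod 2) => Matrix.vecMul x G := by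
  intro c
  obtain ⟨i, hi⟩ := Function.ne_iff.1 hx
  refine ⟨fun i' j => if i' = i then (x i)⁻¹ * c j else 0, ?_⟩
  ext j
  simp only [Matrix.vecMul, dotProduct, mul_ite, mul_zero, Finset.sum_ite_eq', Finset.mem_univ,
    if_true]
  exact mul_inv_cancel_left₀ hi _

theorem mulVec_surjective_left {t n : ℕ} {y : Fin n → ZMod 2} (hy : y ≠ 0) :
    Function.Surjective fun G : Matrix (Fin t) (Fin n) (ZMod 2) => Matrix.mulVec G y := by
  intro c
  obtain ⟨j, hj⟩ := Function.ne_iff.1 hy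
  refine ⟨fun i j' => if j' = j then c i * (y j)⁻¹ else 0, ?_⟩
  ext i
  simp only [Matrix.mulVec, dotProduct, ite_mul, zero_mul, Finset.sum_ite_eq', Finset.mem_univ,
    if_true]
  exact inv_mul_cancel_right₀ hj _

/-- A linear code with a large distance all of whose generator rows but the last span a code with a
large dual distance. -/
theorem exists_generator_matrix (a : ℕ) (ha : 1 ≤ a) :
    ∃ G : Matrix (Fin (24 * a + 1)) (Fin (48 * a)) (ZMod 2),
      (∀ x, x ≠ 0 → a < hammingNorm (Matrix.vecMul x G)) ∧
      ∀ y, y ≠ 0 → hammingNorm y ≤ a →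
        Matrix.mulVec (G.submatrix Fin.castSucc id) y ≠ 0 := by
  classical
  set t := 24 * a with ht
  set n := 48 * a with hn
  let M := Matrix (Fin (t + 1)) (Fin n) (ZMod 2)
  set B := Finset.univ.filter fun u : Fin n → ZMod 2 => hammingNorm u ≤ a with hB
  have hBc : B.card ≤ 2 ^ (12 * a) := card_hammingNorm_le a
  set N := Fintype.card M with hN
  have hNpos : 0 < N := Fintype.card_pos
  have hc : ∀ l : ℕ, Fintype.card (Fin l → ZMod 2) = 2 ^ l := by intro l; simp [ZMod.card]
  let bad1 : Finset M := (Finset.univ.filter fun x : Fin (t + 1) → ZMod 2 => x ≠ 0).biUnion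
    fun x => Finset.univ.filter fun G => Matrix.vecMul x G ∈ B
  let bad2 : Finset M := (B.filter fun y => y ≠ 0).biUnion
    fun y => Finset.univ.filter fun G =>
      Matrix.mulVec (G.submatrix Fin.castSucc id) y ∈ ({0} : Finset (Fin t → ZMod 2))
  have h1 : bad1.card * 2 ^ n ≤ 2 ^ (t + 1) * (B.card * N) := by
    calc bad1.card * 2 ^ n ≤ (∑ x ∈ (Finset.univ.filter fun x : Fin (t + 1) → ZMod 2 => x ≠ 0),
          (Finset.univ.filter fun G : M => Matrix.vecMul x G ∈ B).card) * 2 ^ n :=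
          Nat.mul_le_mul_right _ Finset.card_biUnion_le
      _ = ∑ x ∈ (Finset.univ.filter fun x : Fin (t + 1) → ZMod 2 => x ≠ 0), B.card * N := by
          rw [Finset.sum_mul]
          refine Finset.sum_congr rfl fun x hx => ?_
          have := card_preimage_mul_card (A := M)
            ⟨⟨fun G => Matrix.vecMul x G, Matrix.vecMul_zero x⟩,
              fun G G' => Matrix.vecMul_add G G' x⟩
            (vecMul_surjective_left (Finset.mem_filter.1 hx).2) B
          rw [hc] at this
          exact this
      _ ≤ 2 ^ (t + 1) * (B.card * N) := by
          rw [Finset.sum_const, smul_eq_mul]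
          refine Nat.mul_le_mul_right _ ((Finset.card_le_univ _).trans ?_)
          rw [hc]
  have h2 : bad2.card * 2 ^ t ≤ B.card * N := by
    calc bad2.card * 2 ^ t ≤ (∑ y ∈ (B.filter fun y => y ≠ 0),
          (Finset.univ.filter fun G : M =>
            Matrix.mulVec (G.submatrix Fin.castSucc id) y
              ∈ ({0} : Finset (Fin t → ZMod 2))).card) * 2 ^ t :=
          Nat.mul_le_mul_right _ Finset.card_biUnion_le
      _ = ∑ y ∈ (B.filter fun y => y ≠ 0), N := by
          rw [Finset.sum_mul]
          refine Finset.sum_congr rfl fun y hy => ?_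
          have hs : Function.Surjective fun G : M =>
              Matrix.mulVec (G.submatrix Fin.castSucc id) y := by
            intro c
            obtain ⟨G, hG⟩ := mulVec_surjective_left (t := t) (Finset.mem_filter.1 hy).2 c
            refine ⟨Fin.snoc (α := fun _ => Fin n → ZMod 2) G 0, ?_⟩
            rw [← hG]
            simp only
            congr 1
            ext i j
            exact congrFun (Fin.snoc_castSucc (α := fun _ => Fin n → ZMod 2) 0 G i) j
          have := card_preimage_mul_card (A := M)
            ⟨⟨fun G => Matrix.mulVec (G.submatrix Fin.castSucc id) y, by
              rw [Matrix.submatrix_zero]; exact Matrix.zero_mulVec y⟩,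
              fun G G' => Matrix.add_mulVec _ _ y⟩
            hs {0}
          rw [hc, Finset.card_singleton, one_mul] at this
          exact this
      _ ≤ B.card * N := by
          rw [Finset.sum_const, smul_eq_mul]
          exact Nat.mul_le_mul_right _ (Finset.card_le_card (Finset.filter_subset _ _))
  -- The fractions of bad matrices are at most `2 * 2 ^ (-12 * a)` and `2 ^ (-12 * a)`, so the total
  -- is below 1.
  have hlt : (bad1 ∪ bad2).card < Fintype.card M := by
    refine (Finset.card_union_le _ _).trans_lt ?_
    have e1 : bad1.card * 2 ^ n ≤ 2 ^ (36 * a + 1) * N := by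
      refine h1.trans ?_
      rw [← mul_assoc]
      refine Nat.mul_le_mul_right _ ((Nat.mul_le_mul_left _ hBc).trans_eq ?_)
      rw [← pow_add]; congr 1; omega
    have e2 : bad2.card * 2 ^ n ≤ 2 ^ (36 * a) * N := by
      calc bad2.card * 2 ^ n = bad2.card * 2 ^ t * 2 ^ t := by
            rw [mul_assoc, ← pow_add]; congr 2; omega
        _ ≤ 2 ^ (12 * a) * N * 2 ^ t :=
            Nat.mul_le_mul_right _ (h2.trans (Nat.mul_le_mul_right _ hBc))
        _ = 2 ^ (36 * a) * N := by
            rw [mul_right_comm, ← pow_add]; congr 2; omega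
    have e3 : 3 * 2 ^ (36 * a) < 2 ^ n := by
      have : (2 : ℕ) ^ n = 2 ^ (12 * a) * 2 ^ (36 * a) := by rw [← pow_add]; congr 1; omega
      rw [this]
      refine Nat.mul_lt_mul_of_pos_right ?_ (by positivity)
      calc 3 < 2 ^ 12 := by norm_num
        _ ≤ 2 ^ (12 * a) := Nat.pow_le_pow_right (by norm_num) (by omega)
    refine lt_of_mul_lt_mul_right (a := 2 ^ n) ?_ (Nat.zero_le _)
    calc (bad1.card + bad2.card) * 2 ^ n ≤ (3 * 2 ^ (36 * a)) * N := by
          rw [pow_succ] at e1; nlinarith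
      _ < 2 ^ n * N := Nat.mul_lt_mul_of_pos_right e3 hNpos
      _ = N * 2 ^ n := mul_comm _ _
  obtain ⟨G, hG⟩ : ∃ G : M, G ∉ bad1 ∪ bad2 := by
    by_contra! h
    exact hlt.not_ge (Finset.card_le_card fun G _ => h G)
  refine ⟨G, fun x hx => ?_, fun y hy hya h0 => hG ?_⟩
  · by_contra! hle
    refine hG (Finset.mem_union_left _ (Finset.mem_biUnion.2 ⟨x, by simpa using hx, ?_⟩))
    simpa [hB] using hle
  · refine Finset.mem_union_right _ (Finset.mem_biUnion.2 ⟨y, by simp [hB, hya, hy], ?_⟩)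
    simpa using h0

/-- If no nonzero vector that is supported on `I` is orthogonal to all rows of `G`, then the code
that `G` generates restricts onto `I` surjectively. -/
theorem exists_vecMul_eq_on {t n : ℕ} (G : Matrix (Fin t) (Fin n) (ZMod 2)) (I : Finset (Fin n))
    (hG : ∀ y, y ≠ 0 → (∀ j ∉ I, y j = 0) → Matrix.mulVec G y ≠ 0) (v : Fin n → ZMod 2) :
    ∃ x, ∀ j ∈ I, Matrix.vecMul x G j = v j := by
  classical
  let L : (Fin t → ZMod 2) →ₗ[ZMod 2] (I → ZMod 2) :=
    (LinearMap.funLeft (ZMod 2) (ZMod 2) (fun j : I => (j : Fin n))) ∘ₗ G.vecMulLinear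
  -- A proper range would be killed by a nonzero functional, whose coefficients, extended by zero
  -- outside `I`, are orthogonal to all rows of `G`.
  have hL : LinearMap.range L = ⊤ := by
    by_contra hne
    obtain ⟨f, hf0, hf⟩ := Submodule.exists_le_ker_of_lt_top _ (lt_top_iff_ne_top.2 hne)
    let y : Fin n → ZMod 2 := fun j => if h : j ∈ I then f (Pi.single ⟨j, h⟩ 1) else 0
    have hfy : ∀ z : I → ZMod 2, f z = ∑ j : I, z j * y j := by
      intro z
      rw [LinearMap.pi_apply_eq_sum_univ f z]
      refine Finset.sum_congr rfl fun j _ => ?_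
      have e : (fun k => if j = k then (1 : ZMod 2) else 0) = Pi.single j 1 := by
        ext k; simp [Pi.single_apply, eq_comm]
      simp [y, e]
    refine hG y ?_ (fun j hj => by simp [y, hj]) ?_
    · intro hy
      apply hf0
      ext z
      simp [hfy, hy]
    · ext i
      have h1 : f (L (Pi.single i 1)) = 0 := hf (LinearMap.mem_range_self L _)
      rw [hfy] at h1
      have h2 : ∑ j : I, G i j * y j = 0 := by
        rw [← h1]
        refine Finset.sum_congr rfl fun j _ => ?_
        simp [L, LinearMap.funLeft]
      rw [Finset.sum_coe_sort I (fun j => G i j * y j)] at h2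
      simp only [Matrix.mulVec, dotProduct, Pi.zero_apply]
      rw [← h2]
      refine (Finset.sum_subset (Finset.subset_univ I) fun j _ hj => ?_).symm
      simp [y, hj]
  obtain ⟨x, hx⟩ := LinearMap.range_eq_top.1 hL (fun j => v j)
  exact ⟨x, fun j hj => congrFun hx ⟨j, hj⟩⟩

/-- A generator matrix as above provides a secret-sharing ensemble. -/
theorem exists_ensemble_of_generator_matrix {a t n : ℕ} (ha : 1 ≤ a) (ht : 1 ≤ t)
    (hn : (n : ℝ) = 48 * a) (G : Matrix (Fin (t + 1)) (Fin n) (ZMod 2))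
    (hG1 : ∀ x, x ≠ 0 → a < hammingNorm (Matrix.vecMul x G))
    (hG2 : ∀ y, y ≠ 0 → hammingNorm y ≤ a →
      Matrix.mulVec (G.submatrix Fin.castSucc id) y ≠ 0) :
    ∃ H : Bool → Finset (BitStr n),
      IsSecretSharingEnsemble (1 / 48) (1 / 48) (3 * 2 ^ (t - 1)) n H := by
  classical
  let β : ZMod 2 → Bool := fun z => decide (z = 1)
  have hβ : Function.Injective β := by decide
  let toB : (Fin n → ZMod 2) → BitStr n := fun c j => β (c j)
  let enc : Bool → (Fin t → ZMod 2) → Fin n → ZMod 2 := fun b x =>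
    Matrix.vecMul (Fin.snoc (α := fun _ => ZMod 2) x (if b then 1 else 0)) G
  have hdist : ∀ z z' : Fin (t + 1) → ZMod 2, z ≠ z' →
      a < hammingDist (toB (Matrix.vecMul z G)) (toB (Matrix.vecMul z' G)) := by
    intro z z' h
    have h1 := hG1 (z - z') (sub_ne_zero.2 h)
    rw [Matrix.sub_vecMul, hammingNorm] at h1
    refine h1.trans_le (Finset.card_le_card fun j hj => ?_)
    simp only [Finset.mem_filter, Finset.mem_univ, true_and, Pi.sub_apply, sub_ne_zero] at hj ⊢
    exact fun h => hj (hβ h :)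
  have hinj : ∀ z z' : Fin (t + 1) → ZMod 2,
      toB (Matrix.vecMul z G) = toB (Matrix.vecMul z' G) → z = z' := by
    intro z z' h
    by_contra hne
    have := hdist z z' hne
    rw [h, hammingDist_self] at this
    omega
  have hsnoc : ∀ (b b' : Bool) (x x' : Fin t → ZMod 2),
      (Fin.snoc (α := fun _ => ZMod 2) x (if b then 1 else 0)
      : Fin (t + 1) → ZMod 2) = Fin.snoc (α := fun _ => ZMod 2) x' (if b' then 1 else 0) →
      x = x' ∧ b = b' := by
    intro b b' x x' h
    constructor
    · ext i
      have := congrFun h i.castSucc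
      simpa using this
    · have := congrFun h (Fin.last t)
      simp only [Fin.snoc_last] at this
      revert this
      cases b <;> cases b' <;> simp
  refine ⟨fun b => Finset.univ.image fun x => toB (enc b x), ?_, ?_, ?_, ?_⟩
  · intro b
    rw [Finset.card_image_of_injective _ fun x x' h => (hsnoc _ _ _ _ (hinj _ _ h)).1]
    have h24 : t = (t - 1) + 1 := by omega
    have h2t : (2 : ℝ) ^ t = 2 ^ (t - 1) * 2 := by rw [← pow_succ, ← h24]
    simp only [Finset.card_univ, Fintype.card_fun, ZMod.card, Fintype.card_fin]
    push_cast
    rw [h2t]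
    ring
  · rw [Finset.disjoint_left]
    intro u h0 h1
    obtain ⟨x, -, rfl⟩ := Finset.mem_image.1 h0
    obtain ⟨x', -, h⟩ := Finset.mem_image.1 h1
    exact absurd (hsnoc _ _ _ _ (hinj _ _ h)).2 (by decide)
  · have hmem : ∀ u ∈ (Finset.univ.image fun x => toB (enc false x)) ∪
        (Finset.univ.image fun x => toB (enc true x)),
        ∃ z : Fin (t + 1) → ZMod 2, toB (Matrix.vecMul z G) = u := by
      intro u hu
      rcases Finset.mem_union.1 hu with h | h
      all_goals
        obtain ⟨x, -, rfl⟩ := Finset.mem_image.1 h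
        exact ⟨_, rfl⟩
    intro u hu v hv
    obtain ⟨z, rfl⟩ := hmem u hu
    obtain ⟨z', rfl⟩ := hmem v hv
    by_cases h : z = z'
    · exact Or.inl (by rw [h])
    · right
      have h1 : (a : ℝ) < hammingDist (toB (Matrix.vecMul z G)) (toB (Matrix.vecMul z' G)) := by
        exact_mod_cast hdist z z' h
      have ha' : (0 : ℝ) < a := by exact_mod_cast ha
      rw [strDist, lt_div_iff₀ (by rw [hn]; positivity), hn]
      linarith
  · intro I hI w
    have hIa : I.card ≤ a := by
      rw [hn] at hI
      exact_mod_cast (show (I.card : ℝ) ≤ a by linarith)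
    -- `x₀` encodes a word of the linear code that agrees with the last row on `I`; shifting by it
    -- exchanges the two cosets invisibly on `I`.
    obtain ⟨x₀, hx₀⟩ := exists_vecMul_eq_on (G.submatrix Fin.castSucc id) I (fun y hy hyI =>
      hG2 y hy (le_trans (Finset.card_le_card fun j hj => by
        by_contra hjI
        exact (Finset.mem_filter.1 hj).2 (hyI j hjI)) hIa)) (G (Fin.last t))
    have henc : ∀ b x j, enc b x j = Matrix.vecMul x (G.submatrix Fin.castSucc id) j
        + (if b then 1 else 0) * G (Fin.last t) j := by
      intro b x j
      simp [enc, Matrix.vecMul, dotProduct, Fin.sum_univ_castSucc]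
    have hcard : ∀ b, ((Finset.univ.image fun x => toB (enc b x)).filter
        fun u => ∀ i : I, u i = w i).card
        = (Finset.univ.filter fun x => ∀ i : I, toB (enc b x) i = w i).card := by
      intro b
      rw [Finset.filter_image, Finset.card_image_of_injective _
        fun x x' h => (hsnoc _ _ _ _ (hinj _ _ h)).1]
    have hcardH : ∀ b, (Finset.univ.image fun x => toB (enc b x)).card
        = (Finset.univ : Finset (Fin t → ZMod 2)).card := by
      intro b
      rw [Finset.card_image_of_injective _ fun x x' h => (hsnoc _ _ _ _ (hinj _ _ h)).1]
    have hbij : (Finset.univ.filter fun x => ∀ i : I, toB (enc false x) i = w i).card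
        = (Finset.univ.filter fun x => ∀ i : I, toB (enc true x) i = w i).card := by
      have hkey : ∀ x, ∀ i : I, toB (enc true (x - x₀)) i = toB (enc false x) i := by
        intro x i
        simp only [toB]
        rw [henc, henc, Matrix.sub_vecMul, Pi.sub_apply, hx₀ i i.2]
        simp
      refine Finset.card_nbij' (fun x => x - x₀) (fun x => x + x₀) ?_ ?_ ?_ ?_
      · intro x hx
        simp only [Finset.coe_filter, Finset.mem_univ, true_and, Set.mem_ofPred_eq] at hx ⊢
        intro i
        rw [hkey, hx i]
      · intro x hx
        simp only [Finset.coe_filter, Finset.mem_univ, true_and, Set.mem_ofPred_eq] at hx ⊢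
        intro i
        rw [← hkey, add_sub_cancel_right, hx i]
      · intro x _; simp
      · intro x _; simp
    unfold restrictionProb
    rw [hcardH, hcardH]
    congr 2
    convert (hcard false).trans (hbij.trans (hcard true).symm)

/-- Secret-sharing constants exist. -/
theorem exists_areSecretSharingConstants : ∃ δ ζ η : ℝ, AreSecretSharingConstants δ ζ η := by
  -- Both `δ` and `ζ` are `a / n` with `a = k` and `n = 48 * k`; `η = 2` works because `log₂ m ≥ 24
  -- * k`.
  refine ⟨1 / 48, 1 / 48, 2, by norm_num, by norm_num, by norm_num, fun k hk => ?_⟩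
  refine ⟨3 * 2 ^ (24 * k - 1), 48 * k, ?_, dvd_mul_right _ _, ?_,
    ?_⟩
  · have : k < 2 ^ (24 * k - 1) :=
      Nat.lt_two_pow_self.trans_le (Nat.pow_le_pow_right (by norm_num) (by omega))
    omega
  · have h1 : ((24 * k : ℕ) : ℝ) ≤ Real.logb 2 ((3 * 2 ^ (24 * k - 1) : ℕ) : ℝ) := by
      rw [Real.le_logb_iff_rpow_le (by norm_num) (by positivity), Real.rpow_natCast]
      have h24 : 24 * k = (24 * k - 1) + 1 := by omega
      have : (2 : ℕ) ^ (24 * k) ≤ 3 * 2 ^ (24 * k - 1) := by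
        conv_lhs => rw [h24, pow_succ]
        omega
      exact_mod_cast this
    push_cast at h1 ⊢
    linarith
  · obtain ⟨G, hG1, hG2⟩ := exists_generator_matrix k hk
    exact exists_ensemble_of_generator_matrix hk (by omega) (by push_cast; ring) G hG1 hG2

/-! ### Farness from bounded support -/

open Classical in
/-- If `P` has mass at least `c` outside of the `r`-neighbourhood of every set of at most `m`
strings, then its earth mover's distance from the distributions on `m` strings is at least
`c r`. -/
theorem isFar_boundedSupport {n m : ℕ} {P : PMF (BitStr n)} {r c ε : ℝ}
    (hc : 0 < c) (hε : ε < c * r) (hεpos : 0 < ε)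
    (h : ∀ S : Finset (BitStr n), S.card ≤ m →
      ENNReal.ofReal c ≤ ∑ u with ∀ v ∈ S, r ≤ strDist u v, P u) :
    IsFar ε P (boundedSupport n m) := by
  have hlt : ENNReal.ofReal ε < ENNReal.ofReal (c * r) :=
    (ENNReal.ofReal_lt_ofReal_iff (hεpos.trans hε)).2 hε
  refine hlt.trans_le ?_
  refine le_iInf₂ fun Q hQ => le_iInf₂ fun T hT => ?_
  obtain ⟨hT1, hT2⟩ := hT
  let S : Finset (BitStr n) := Finset.univ.filter fun v => Q v ≠ 0
  have hS : S.card ≤ m := by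
    have : (S : Set (BitStr n)) = Q.support := by
      ext v; simp [S, PMF.mem_support_iff]
    rw [← Set.ncard_coe_finset, this]
    exact hQ
  -- A transfer moves mass only into the support `S` of `Q`, so mass that lies `r`-far from `S`
  -- costs at least `r` per unit.
  have hT2' : ∀ p, T p ≠ 0 → p.2 ∈ S := by
    intro p hp
    have : p.2 ∈ (T.map Prod.snd).support := by
      rw [PMF.support_map]
      exact ⟨p, hp, rfl⟩
    rw [hT2] at this
    simpa [S] using this
  have hT1' : ∀ u, P u = ∑ v, T (u, v) := by
    intro u
    rw [← hT1, PMF.map_apply, tsum_fintype, Fintype.sum_prod_type]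
    rw [Finset.sum_eq_single u]
    · simp
    · intro b _ hb
      simp [Ne.symm hb]
    · simp
  rw [Fintype.sum_prod_type, ENNReal.ofReal_mul hc.le]
  calc ENNReal.ofReal c * ENNReal.ofReal r
      ≤ (∑ u with ∀ v ∈ S, r ≤ strDist u v, P u) * ENNReal.ofReal r := by
        gcongr; exact h S hS
    _ = ∑ u with ∀ v ∈ S, r ≤ strDist u v, ∑ v, T (u, v) * ENNReal.ofReal r := by
        rw [Finset.sum_mul]
        refine Finset.sum_congr rfl fun u _ => ?_
        rw [hT1' u, Finset.sum_mul]
    _ ≤ ∑ u with ∀ v ∈ S, r ≤ strDist u v, ∑ v, T (u, v) * ENNReal.ofReal (strDist u v) := by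
        refine Finset.sum_le_sum fun u hu => Finset.sum_le_sum fun v _ => ?_
        by_cases h0 : T (u, v) = 0
        · simp [h0]
        · gcongr
          exact (Finset.mem_filter.1 hu).2 v (hT2' (u, v) h0)
    _ ≤ ∑ u, ∑ v, T (u, v) * ENNReal.ofReal (strDist u v) :=
        Finset.sum_le_sum_of_subset (Finset.filter_subset _ _)

/-! ### Queries and colorings of the contradiction graph -/

/-- Two inputs that agree on the queries made on the first one lead to the same queries. -/
theorem DecisionTree.queries_congr {s n : ℕ} {x y : Fin s → BitStr n} (T : DecisionTree s n)
    (h : ∀ p ∈ T.queries x, x p.1 p.2 = y p.1 p.2) : T.queries y = T.queries x := by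
  induction T with
  | leaf => rfl
  | query i j next ih =>
    simp only [queries, Finset.mem_insert, forall_eq_or_imp] at h ⊢
    rw [← h.1, ih _ h.2]

theorem DecisionTree.card_queries_le {s n : ℕ} (x : Fin s → BitStr n) (T : DecisionTree s n) :
    (T.queries x).card ≤ T.height := by
  induction T with
  | leaf => simp [queries]
  | query i j next ih =>
    simp only [queries, height]
    refine (Finset.card_insert_le _ _).trans ?_
    have := ih (x i j)
    rcases h : x i j <;> rw [h] at this <;> omega

/-- The indices at which the sample `i` is queried. -/
def indicesOf {s n : ℕ} (Q : Finset (Fin s × Fin n)) (i : Fin s) : Finset (Fin n) :=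
  Finset.univ.filter fun j => (i, j) ∈ Q

theorem mem_indicesOf {s n : ℕ} {Q : Finset (Fin s × Fin n)} {i : Fin s} {j : Fin n} :
    j ∈ indicesOf Q i ↔ (i, j) ∈ Q := by simp [indicesOf]

theorem sum_card_indicesOf {s n : ℕ} (Q : Finset (Fin s × Fin n)) :
    ∑ i, (indicesOf Q i).card = Q.card := by
  rw [Finset.card_eq_sum_card_fiberwise (f := Prod.fst) (t := Finset.univ) (by simp)]
  refine Finset.sum_congr rfl fun i _ => ?_
  refine Finset.card_nbij' (fun j => (i, j)) Prod.snd ?_ ?_ ?_ ?_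
  · intro j hj; simpa [mem_indicesOf] using hj
  · rintro ⟨i', j⟩ hj
    simp only [Finset.coe_filter, Set.mem_ofPred_eq] at hj
    obtain ⟨hj, rfl⟩ := hj
    simpa [mem_indicesOf] using hj
  · intro j _; rfl
  · rintro ⟨i', j⟩ hj
    simp only [Finset.coe_filter, Set.mem_ofPred_eq] at hj
    rw [← hj.2]

/-- Only few samples are queried more than `c` times each. -/
theorem card_filter_indicesOf_mul_le {s n : ℕ} (Q : Finset (Fin s × Fin n)) (c : ℝ) :
    ((Finset.univ.filter fun i => c ≤ ((indicesOf Q i).card : ℝ)).card : ℝ) * c ≤ Q.card := by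
  rw [← sum_card_indicesOf, ← nsmul_eq_mul, ← Finset.sum_const, Nat.cast_sum]
  exact (Finset.sum_le_sum fun i hi => (Finset.mem_filter.1 hi).2).trans
    (Finset.sum_le_sum_of_subset_of_nonneg (Finset.filter_subset _ _) fun _ _ _ => by positivity)

/-- A contradiction graph is colorable if all samples but `a` ones are consistent with one of `b`
strings at the indices where they are queried. -/
theorem contradictionGraph_colorable {s n a b m : ℕ} (x : Fin s → BitStr n)
    (Q : Finset (Fin s × Fin n)) (A : Finset (Fin s)) (B : Finset (BitStr n))
    (hA : A.card ≤ a) (hB : B.card ≤ b) (hab : a + b ≤ m)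
    (h : ∀ i ∉ A, ∃ u ∈ B, ∀ j ∈ indicesOf Q i, x i j = u j) :
    (contradictionGraph x Q).Colorable m := by
  classical
  choose! f hfB hf using h
  let C : (contradictionGraph x Q).Coloring (A ⊕ B) := SimpleGraph.Coloring.mk
    (fun i => if hi : i ∈ A then Sum.inl ⟨i, hi⟩ else Sum.inr ⟨f i, hfB i hi⟩) (by
      rintro i i' ⟨j, hj, hi, hi'⟩ heq
      by_cases h1 : i ∈ A <;> by_cases h2 : i' ∈ A
      · simp only [h1, h2, dif_pos, Sum.inl.injEq, Subtype.mk.injEq] at heq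
        exact hj (by rw [heq])
      · simp [h1, h2] at heq
      · simp [h1, h2] at heq
      · simp only [h1, h2, dif_neg, not_false_eq_true, Sum.inr.injEq, Subtype.mk.injEq] at heq
        exact hj (by rw [hf i h1 j (mem_indicesOf.2 hi), hf i' h2 j (mem_indicesOf.2 hi'), heq]))
  refine C.colorable.mono ?_
  simp only [Fintype.card_sum, Fintype.card_coe]
  omega

/-! ### Hamming balls and farness of the uniform distribution -/

/-- The number of strings within Hamming distance `r` of a given string. -/
def ballVolume (n r : ℕ) : ℕ := ∑ i ∈ Finset.range (r + 1), n.choose i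

theorem card_hammingDist_eq {n : ℕ} (v : BitStr n) (i : ℕ) :
    (Finset.univ.filter fun u : BitStr n => hammingDist u v = i).card = n.choose i := by
  have h : (Finset.powersetCard i (Finset.univ : Finset (Fin n))).card = n.choose i := by
    rw [Finset.card_powersetCard, Finset.card_univ, Fintype.card_fin]
  rw [← h]
  refine Finset.card_nbij' (fun u => Finset.univ.filter fun j => u j ≠ v j)
    (fun D j => if j ∈ D then !v j else v j) ?_ ?_ ?_ ?_
  · intro u hu
    simpa [hammingDist, Finset.mem_powersetCard] using hu
  · intro D hD
    have hD' : D.card = i := (Finset.mem_powersetCard.1 hD).2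
    simp only [Finset.coe_filter, Finset.mem_univ, true_and, Set.mem_ofPred_eq]
    rw [← hD', hammingDist]
    congr 1
    ext j
    by_cases hj : j ∈ D <;> simp [hj]
  · intro u _
    ext j
    by_cases hj : u j = v j
    · simp [hj]
    · simp only [Finset.mem_filter, Finset.mem_univ, true_and, ne_eq, hj, not_false_eq_true,
        if_true]
      revert hj
      cases u j <;> cases v j <;> simp
  · intro D _
    ext j
    by_cases hj : j ∈ D <;> simp [hj]

theorem card_hammingDist_le {n : ℕ} (v : BitStr n) (r : ℕ) :
    (Finset.univ.filter fun u : BitStr n => hammingDist u v ≤ r).card = ballVolume n r := by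
  rw [Finset.card_eq_sum_card_fiberwise (f := fun u => hammingDist u v)
    (t := Finset.range (r + 1)) (by
      intro u hu
      simp only [Finset.coe_filter, Finset.mem_univ, true_and, Set.mem_ofPred_eq] at hu
      simpa [Nat.lt_succ_iff] using hu), ballVolume]
  refine Finset.sum_congr rfl fun i hi => ?_
  rw [← card_hammingDist_eq v i, Finset.filter_filter]
  congr 1
  ext u
  simp only [Finset.mem_filter, Finset.mem_univ, true_and]
  have := Finset.mem_range.1 hi
  omega

/-- Termwise: consecutive binomials have ratio `(n - i) / (i + 1)`, which is at least `5 / 4` as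
long as `9 * i + 5 ≤ 4 * n`. -/
theorem ballVolume_succ {n r : ℕ} (h : 9 * r + 5 ≤ 4 * n) :
    5 * ballVolume n r ≤ 4 * ballVolume n (r + 1) := by
  have h1 : ∀ i ∈ Finset.range (r + 1), 5 * n.choose i ≤ 4 * n.choose (i + 1) := by
    intro i hi
    have hi' := Finset.mem_range.1 hi
    refine Nat.le_of_mul_le_mul_right ?_ (Nat.succ_pos i)
    rw [mul_assoc 4, Nat.succ_eq_add_one, Nat.choose_succ_right_eq, mul_right_comm, mul_left_comm,
      mul_comm]
    exact Nat.mul_le_mul_left _ (by omega)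
  unfold ballVolume
  rw [Finset.sum_range_succ' _ (r + 1), Finset.mul_sum, mul_add, Finset.mul_sum]
  exact (Finset.sum_le_sum h1).trans (Nat.le_add_right _ _)

/-- Five growth steps suffice since `(5 / 4) ^ 5 > 3`; the last one, at radius `r + 4`, accounts for
the 41. -/
theorem three_mul_ballVolume_le {n r : ℕ} (h : 9 * r + 41 ≤ 4 * n) :
    3 * ballVolume n r ≤ ballVolume n (r + 5) := by
  have h0 : 5 * ballVolume n r ≤ 4 * ballVolume n (r + 1) := ballVolume_succ (by omega)
  have h1 : 5 * ballVolume n (r + 1) ≤ 4 * ballVolume n (r + 2) := ballVolume_succ (by omega)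
  have h2 : 5 * ballVolume n (r + 2) ≤ 4 * ballVolume n (r + 3) := ballVolume_succ (by omega)
  have h3 : 5 * ballVolume n (r + 3) ≤ 4 * ballVolume n (r + 4) := ballVolume_succ (by omega)
  have h4 : 5 * ballVolume n (r + 4) ≤ 4 * ballVolume n (r + 5) := ballVolume_succ (by omega)
  omega

/-- The sphere packing bound. -/
theorem card_mul_ballVolume_le {n R : ℕ} (C : Finset (BitStr n))
    (hC : ∀ u ∈ C, ∀ v ∈ C, u = v ∨ 2 * R < hammingDist u v) :
    C.card * ballVolume n R ≤ 2 ^ n := by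
  have hdisj : (C : Set (BitStr n)).PairwiseDisjoint
      fun v => Finset.univ.filter fun u : BitStr n => hammingDist u v ≤ R := by
    intro u hu v hv huv
    rw [Function.onFun, Finset.disjoint_left]
    intro w hw hw'
    simp only [Finset.mem_filter, Finset.mem_univ, true_and] at hw hw'
    have h1 := (hC u hu v hv).resolve_left huv
    have h2 := hammingDist_triangle_left u v w
    omega
  have h := Finset.card_biUnion hdisj
  simp only [card_hammingDist_le, Finset.sum_const, smul_eq_mul] at h
  rw [← h]
  refine (Finset.card_le_univ _).trans_eq ?_
  simp

/-- The uniform distribution is far from being supported on `m` strings, when there is a code of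
large distance with `4 / 3 m` words. -/
theorem isFar_uniformOfFintype {n m : ℕ} {δ ε : ℝ} (C : Finset (BitStr n))
    (hC : ∀ u ∈ C, ∀ v ∈ C, u = v ∨ δ < strDist u v) (hcard : 4 * m ≤ 3 * C.card)
    (hδ0 : 0 < δ) (hδ : δ < 1) (hn : 66 ≤ n) (hδn : 40 ≤ δ * n) (hε0 : 0 < ε)
    (hε : ε < 1 / 4 * δ) :
    IsFar ε (PMF.uniformOfFintype (BitStr n)) (boundedSupport n m) := by
  classical
  have hn0 : (0 : ℝ) < n := by exact_mod_cast (show 0 < n by omega)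
  -- The product `c * r = 9 / 32 * δ` exceeds `δ / 4`.
  refine isFar_boundedSupport (r := 3 / 8 * δ) (c := 3 / 4) (by norm_num) (by linarith) hε0 ?_
  intro S hS
  set ρ := ⌊3 / 8 * δ * n⌋₊ with hρ
  have hρle : (ρ : ℝ) ≤ 3 / 8 * δ * n := Nat.floor_le (by positivity)
  have hgrow : 3 * ballVolume n ρ ≤ ballVolume n (ρ + 5) := by
    refine three_mul_ballVolume_le ?_
    have h1 : (ρ : ℝ) ≤ 3 / 8 * n := by nlinarith
    have h2 : (66 : ℝ) ≤ n := by exact_mod_cast hn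
    have : (9 * ρ + 41 : ℝ) ≤ 4 * n := by linarith
    exact_mod_cast this
  -- The larger radius still packs: `2 * (ρ + 5) ≤ 3 / 4 * δ * n + 10 ≤ δ * n`, as `40 ≤ δ * n`.
  have hpack := card_mul_ballVolume_le (R := ρ + 5) C fun u hu v hv => (hC u hu v hv).imp_right
    fun h => by
      rw [strDist, lt_div_iff₀ hn0] at h
      have : ((2 * (ρ + 5) : ℕ) : ℝ) < hammingDist u v := by push_cast; linarith
      exact_mod_cast this
  -- Radius-`ρ` balls around `m` strings thus cover at most a quarter of the cube.
  have h4 : 4 * (m * ballVolume n ρ) ≤ 2 ^ n := by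
    have : 3 * (4 * m) * ballVolume n ρ ≤ 3 * C.card * ballVolume n (ρ + 5) := by
      calc 3 * (4 * m) * ballVolume n ρ = (4 * m) * (3 * ballVolume n ρ) := by ring
        _ ≤ _ := Nat.mul_le_mul hcard hgrow
    nlinarith
  set F := Finset.univ.filter fun u : BitStr n => ∀ v ∈ S, 3 / 8 * δ ≤ strDist u v with hF
  have hcov : (Finset.univ.filter fun u : BitStr n => ¬ ∀ v ∈ S, 3 / 8 * δ ≤ strDist u v).card
      ≤ m * ballVolume n ρ := by
    have hsub : (Finset.univ.filter fun u : BitStr n => ¬ ∀ v ∈ S, 3 / 8 * δ ≤ strDist u v)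
        ⊆ S.biUnion fun v => Finset.univ.filter fun u : BitStr n => hammingDist u v ≤ ρ := by
      intro u hu
      have hu' := (Finset.mem_filter.1 hu).2
      push Not at hu'
      obtain ⟨v, hv, h⟩ := hu'
      refine Finset.mem_biUnion.2 ⟨v, hv, Finset.mem_filter.2 ⟨Finset.mem_univ _, ?_⟩⟩
      rw [strDist, div_lt_iff₀ hn0] at h
      exact Nat.le_floor h.le
    refine (Finset.card_le_card hsub).trans (Finset.card_biUnion_le.trans ?_)
    simp only [card_hammingDist_le, Finset.sum_const, smul_eq_mul]
    exact Nat.mul_le_mul_right _ hS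
  have htot := Finset.card_filter_add_card_filter_not (s := (Finset.univ : Finset (BitStr n)))
    (fun u => ∀ v ∈ S, 3 / 8 * δ ≤ strDist u v)
  have h2n : (Finset.univ : Finset (BitStr n)).card = 2 ^ n := by simp
  rw [h2n, ← hF] at htot
  have hF4 : 3 * 2 ^ n ≤ 4 * F.card := by omega
  simp only [PMF.uniformOfFintype_apply, Finset.sum_const, nsmul_eq_mul]
  rw [Fintype.card_fun, Fintype.card_bool, Fintype.card_fin, ← div_eq_mul_inv,
    ENNReal.le_div_iff_mul_le (by simp) (by simp)]
  rw [show ((2 ^ n : ℕ) : ℝ≥0∞) = ENNReal.ofReal ((2 ^ n : ℕ) : ℝ) from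
      (ENNReal.ofReal_natCast _).symm, ← ENNReal.ofReal_natCast F.card,
    ← ENNReal.ofReal_mul (by norm_num)]
  refine ENNReal.ofReal_le_ofReal ?_
  have : (3 * (2 ^ n : ℕ) : ℝ) ≤ 4 * F.card := by exact_mod_cast hF4
  linarith

/-! ### No witness with few queries -/

theorem card_agree {n : ℕ} (I : Finset (Fin n)) (w : BitStr n) :
    (Finset.univ.filter fun u : BitStr n => ∀ j ∈ I, w j = u j).card * 2 ^ I.card = 2 ^ n := by
  have h : (Finset.univ.filter fun u : BitStr n => ∀ j ∈ I, w j = u j)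
      = Fintype.piFinset fun j => if j ∈ I then {w j} else Finset.univ := by
    ext u
    simp only [Finset.mem_filter, Finset.mem_univ, true_and, Fintype.mem_piFinset]
    refine forall_congr' fun j => ?_
    by_cases hj : j ∈ I
    · simpa [hj] using eq_comm
    · simp [hj]
  rw [h, Fintype.card_piFinset]
  have h1 : ∀ j, (if j ∈ I then {w j} else (Finset.univ : Finset Bool)).card
      = if j ∈ I then 1 else 2 := by
    intro j
    split_ifs
    · exact Finset.card_singleton _
    · rfl
  simp only [h1]
  rw [Finset.prod_ite, Finset.prod_const_one, one_mul, Finset.prod_const, ← pow_add]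
  congr 1
  have := Finset.card_filter_add_card_filter_not (s := (Finset.univ : Finset (Fin n)))
    (fun j => j ∈ I)
  simp only [Finset.card_univ, Fintype.card_fin, Finset.filter_univ_mem] at this
  omega

/-- A few strings agree with many partial strings with few specified bits. -/
theorem exists_agreeing_strings {ι : Type*} {n K : ℕ} (N : Finset ι) (I : ι → Finset (Fin n))
    (w : ι → BitStr n) {p : ℝ} (hp : ∀ i ∈ N, p * 2 ^ (I i).card ≤ 1)
    (hN : (N.card : ℝ) * (1 - p) ^ K < 1) :
    ∃ z : Fin K → BitStr n, ∀ i ∈ N, ∃ k, ∀ j ∈ I i, w i j = z k j := by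
  classical
  by_contra! hcon
  let D : ι → Finset (BitStr n) := fun i => Finset.univ.filter fun u => ¬ ∀ j ∈ I i, w i j = u j
  have hD : ∀ i ∈ N, ((D i).card : ℝ) ≤ 2 ^ n * (1 - p) := by
    intro i hi
    have h1 := Finset.card_filter_add_card_filter_not (s := (Finset.univ : Finset (BitStr n)))
      (fun u => ∀ j ∈ I i, w i j = u j)
    have h2n : (Finset.univ : Finset (BitStr n)).card = 2 ^ n := by simp
    rw [h2n] at h1
    have h2 := card_agree (I i) (w i)
    set c := (Finset.univ.filter fun u : BitStr n => ∀ j ∈ I i, w i j = u j).card with hc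
    have h1' : (c : ℝ) + (D i).card = 2 ^ n := by exact_mod_cast h1
    have h2' : (c : ℝ) * 2 ^ (I i).card = 2 ^ n := by exact_mod_cast h2
    have h3 : p * 2 ^ n ≤ c := by
      rw [← h2']
      calc p * (c * 2 ^ (I i).card) = c * (p * 2 ^ (I i).card) := by ring
        _ ≤ c * 1 := by gcongr; exact hp i hi
        _ = c := mul_one _
    linarith
  -- If every `K`-tuple of strings misses some `i`, the tuples are covered by the products of the `D
  -- i`, too small by the union bound.
  have hcover : (Finset.univ : Finset (Fin K → BitStr n))
      ⊆ N.biUnion fun i => Fintype.piFinset fun _ => D i := by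
    intro z _
    obtain ⟨i, hi, h⟩ := hcon z
    refine Finset.mem_biUnion.2 ⟨i, hi, Fintype.mem_piFinset.2 fun k => ?_⟩
    obtain ⟨j, hj, hne⟩ := h k
    exact Finset.mem_filter.2 ⟨Finset.mem_univ _, fun hall => hne (hall j hj)⟩
  have hle := (Finset.card_le_card hcover).trans Finset.card_biUnion_le
  simp only [Fintype.card_piFinset, Finset.prod_const, Finset.card_univ, Fintype.card_fun,
    Fintype.card_bool, Fintype.card_fin] at hle
  have hle' : ((2 : ℝ) ^ n) ^ K ≤ ∑ i ∈ N, ((D i).card : ℝ) ^ K := by exact_mod_cast hle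
  have h1 : ∑ i ∈ N, ((D i).card : ℝ) ^ K ≤ N.card * (2 ^ n * (1 - p)) ^ K := by
    rw [← nsmul_eq_mul, ← Finset.sum_const]
    exact Finset.sum_le_sum fun i hi => pow_le_pow_left₀ (by positivity) (hD i hi) _
  rw [mul_pow, mul_left_comm] at h1
  have h2 : ((2 : ℝ) ^ n) ^ K * (N.card * (1 - p) ^ K) < ((2 : ℝ) ^ n) ^ K * 1 := by gcongr
  linarith

/-- Fewer than `m log₂ m / 6` queries never disprove that there are only `m` different samples. -/
theorem contradictionGraph_colorable_of_card_le {s n m : ℕ} (x : Fin s → BitStr n)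
    (Q : Finset (Fin s × Fin n)) (h3 : 3 ∣ m) (hm : 1400 ≤ m)
    (hQ : (Q.card : ℝ) ≤ 1 / 6 * m * Real.logb 2 m) : (contradictionGraph x Q).Colorable m := by
  classical
  obtain ⟨a, rfl⟩ := h3
  set m := 3 * a with hma
  have hm' : (1400 : ℝ) ≤ m := by exact_mod_cast hm
  have hma' : (m : ℝ) = 3 * a := by rw [hma]; push_cast; ring
  have hm0 : (0 : ℝ) < m := by linarith
  have hlog0 : 0 < Real.logb 2 m := Real.logb_pos (by norm_num) (by linarith)
  have hlogm : Real.logb 2 m ≤ m := by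
    rw [Real.logb_le_iff_le_rpow (by norm_num) hm0, Real.rpow_natCast]
    exact_mod_cast Nat.lt_two_pow_self.le
  -- `A` collects the samples that get a color of their own. Samples without queries belong to
  -- neither `A` nor `N`: they are consistent with any string.
  let A : Finset (Fin s) := Finset.univ.filter fun i =>
    1 / 2 * Real.logb 2 m ≤ ((indicesOf Q i).card : ℝ)
  let N : Finset (Fin s) := Finset.univ.filter fun i =>
    ((indicesOf Q i).card : ℝ) < 1 / 2 * Real.logb 2 m ∧ indicesOf Q i ≠ ∅
  have hA : A.card ≤ a := by
    have h := (card_filter_indicesOf_mul_le Q (1 / 2 * Real.logb 2 m)).trans hQ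
    have h' : (A.card : ℝ) * (1 / 2 * Real.logb 2 m) ≤ a * (1 / 2 * Real.logb 2 m) := by
      refine h.trans_eq ?_
      rw [hma']; ring
    exact_mod_cast le_of_mul_le_mul_right h' (by positivity)
  have hN : (N.card : ℝ) ≤ 1 / 6 * m ^ 2 := by
    have h := card_filter_indicesOf_mul_le Q 1
    have hsub : N ⊆ Finset.univ.filter fun i => (1 : ℝ) ≤ ((indicesOf Q i).card : ℝ) := by
      intro i hi
      have h1 : 1 ≤ (indicesOf Q i).card :=
        Finset.card_pos.2 (Finset.nonempty_iff_ne_empty.2 (Finset.mem_filter.1 hi).2.2)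
      exact Finset.mem_filter.2 ⟨Finset.mem_univ _, by exact_mod_cast h1⟩
    have h1 : (N.card : ℝ)
        ≤ ((Finset.univ.filter fun i => (1 : ℝ) ≤ ((indicesOf Q i).card : ℝ)).card : ℝ) := by
      exact_mod_cast Finset.card_le_card hsub
    have h2 : (m : ℝ) * Real.logb 2 m ≤ m * m := by gcongr
    nlinarith
  -- A random string matches fewer than `log₂ m / 2` prescribed bits with probability at least `1 /
  -- √m`.
  set p : ℝ := (√m)⁻¹ with hp
  have hsq : 1 ≤ √(m : ℝ) := Real.one_le_sqrt.2 (by linarith)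
  have hp1 : p ≤ 1 := inv_le_one_of_one_le₀ hsq
  have hsqm : √(m : ℝ) * √m = m := Real.mul_self_sqrt hm0.le
  obtain ⟨z, hz⟩ := exists_agreeing_strings (K := 2 * a) N (indicesOf Q) x (p := p) (by
    intro i hi
    have h1 := (Finset.mem_filter.1 hi).2.1
    have h2 : (2 : ℝ) ^ (indicesOf Q i).card ≤ √m := by
      rw [← Real.rpow_natCast, Real.sqrt_eq_rpow]
      calc (2 : ℝ) ^ ((indicesOf Q i).card : ℝ) ≤ 2 ^ (Real.logb 2 m * (1 / 2)) :=
            Real.rpow_le_rpow_of_exponent_le (by norm_num) (by linarith)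
        _ = (m : ℝ) ^ (1 / 2 : ℝ) := by
            rw [Real.rpow_mul (by norm_num), Real.rpow_logb (by norm_num) (by norm_num) hm0]
    rw [hp, inv_mul_le_iff₀ (by linarith), mul_one]
    exact h2) (by
    set y : ℝ := 2 / 3 * √m with hy
    have hpow : (1 - p) ^ (2 * a) ≤ Real.exp (-y) := by
      have h1 : (1 - p) ≤ Real.exp (-p) := by
        have := Real.add_one_le_exp (-p); linarith
      calc (1 - p) ^ (2 * a) ≤ Real.exp (-p) ^ (2 * a) :=
            pow_le_pow_left₀ (by linarith) h1 _
        _ = Real.exp (-y) := by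
            rw [← Real.exp_nat_mul]
            congr 1
            have : (a : ℝ) = √m * √m / 3 := by rw [hsqm, hma']; ring
            push_cast
            rw [this, hp, hy]
            field_simp
    -- The sixth-order term of `exp y` is cubic in `m`, so it beats the bound `m ^ 2 / 6` on
    -- `N.card` once `m ≥ 1400`.
    have hexp : y ^ 6 / 720 ≤ Real.exp y := by
      have := Real.pow_div_factorial_le_exp y (by positivity) 6
      simpa [Nat.factorial] using this
    have hy6 : y ^ 6 = 64 / 729 * m ^ 3 := by
      have : y ^ 2 = 4 / 9 * m := by rw [hy, mul_pow, sq (√_), hsqm]; ring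
      calc y ^ 6 = (y ^ 2) ^ 3 := by ring
        _ = _ := by rw [this]; ring
    have hlt : (N.card : ℝ) < Real.exp y := by
      refine hN.trans_lt (lt_of_lt_of_le ?_ hexp)
      rw [hy6]
      have hmm : (1400 : ℝ) * m ^ 2 ≤ m ^ 3 := by
        rw [pow_succ (m : ℝ) 2, mul_comm]
        gcongr
      have : (0 : ℝ) < m ^ 2 := by positivity
      linarith
    calc (N.card : ℝ) * (1 - p) ^ (2 * a) ≤ N.card * Real.exp (-y) := by gcongr
      _ < Real.exp y * Real.exp (-y) := by gcongr
      _ = 1 := by rw [← Real.exp_add]; simp)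
  refine contradictionGraph_colorable x Q A (Finset.univ.image z) (b := 2 * a) hA
    (Finset.card_image_le.trans_eq (by simp)) (by omega) fun i hi => ?_
  by_cases hI : indicesOf Q i = ∅
  · exact ⟨z ⟨0, by omega⟩, Finset.mem_image_of_mem _ (Finset.mem_univ _), by simp [hI]⟩
  · obtain ⟨k, hk⟩ := hz i (Finset.mem_filter.2 ⟨Finset.mem_univ _, by
      by_contra! h
      exact hi (Finset.mem_filter.2 ⟨Finset.mem_univ _, h⟩), hI⟩)
    exact ⟨z k, Finset.mem_image_of_mem _ (Finset.mem_univ _), hk⟩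

/-! ### Secret sharing against adaptive queries -/

namespace IsSecretSharingEnsemble

variable {δ ζ : ℝ} {m n : ℕ} {H : Bool → Finset (BitStr n)}

theorem three_mul_card (hH : IsSecretSharingEnsemble δ ζ m n H) (b : Bool) :
    3 * (H b).card = 2 * m := by
  have := hH.card_eq b
  have h : (3 * (H b).card : ℝ) = 2 * m := by rw [this]; ring
  exact_mod_cast h

/-- Restrictions to few indices are attained equally often in both parts of the ensemble. -/
theorem card_restriction_eq (hH : IsSecretSharingEnsemble δ ζ m n H) (hm : 0 < m)
    (I : Finset (Fin n)) (hI : (I.card : ℝ) ≤ ζ * n) (w : BitStr n) :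
    ((H false).filter fun u => ∀ j ∈ I, u j = w j).card
      = ((H true).filter fun u => ∀ j ∈ I, u j = w j).card := by
  classical
  have h := hH.shared_secret I hI fun i => w i
  have h0 : (H false).card = (H true).card := by
    have h1 := hH.three_mul_card false
    have h2 := hH.three_mul_card true
    omega
  have hpos : (0 : ℝ) < (H true).card := by
    have h2 := hH.three_mul_card true
    exact_mod_cast (show 0 < (H true).card by omega)
  unfold restrictionProb at h
  rw [h0, div_left_inj' hpos.ne'] at h
  have h' := Nat.cast_injective h
  have e : ∀ b, ((H b).filter fun u => ∀ j ∈ I, u j = w j)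
      = (H b).filter fun u => ∀ i : I, u i = w i := by
    intro b
    refine Finset.filter_congr fun u _ => ?_
    simp
  rw [e, e]
  convert h'

/-- A set of at most `ζ n` indices that is chosen adaptively has the same distribution for both
parts of the ensemble. -/
theorem card_adaptive_eq (hH : IsSecretSharingEnsemble δ ζ m n H) (hm : 0 < m)
    (f : BitStr n → Finset (Fin n)) (hf : ∀ u u', (∀ j ∈ f u, u j = u' j) → f u' = f u) :
    ((H false).filter fun u => ζ * n < ((f u).card : ℝ)).card
      = ((H true).filter fun u => ζ * n < ((f u).card : ℝ)).card := by
  classical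
  -- Sharing only applies to few indices, so the complementary event is counted, grouped by the
  -- transcript `g u` of indices and bits read.
  have hlight : ((H false).filter fun u => ¬ ζ * n < ((f u).card : ℝ)).card
      = ((H true).filter fun u => ¬ ζ * n < ((f u).card : ℝ)).card := by
    let g : BitStr n → Finset (Fin n) × BitStr n := fun u =>
      (f u, fun j => if j ∈ f u then u j else false)
    rw [Finset.card_eq_sum_card_fiberwise (f := g) (t := Finset.univ) (by simp),
      Finset.card_eq_sum_card_fiberwise (f := g) (t := Finset.univ) (by simp)]
    refine Finset.sum_congr rfl fun p _ => ?_
    by_cases hex : ∃ u₀, ¬ ζ * n < ((f u₀).card : ℝ) ∧ g u₀ = p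
    · obtain ⟨u₀, hu₀, rfl⟩ := hex
      -- As `f` depends only on the bits it reads, a transcript class is exactly the set of words
      -- agreeing with `u₀` on `f u₀`.
      have e : ∀ b, (((H b).filter fun u => ¬ ζ * n < ((f u).card : ℝ)).filter
          fun u => g u = g u₀) = (H b).filter fun u => ∀ j ∈ f u₀, u j = u₀ j := by
        intro b
        ext u
        simp only [Finset.mem_filter]
        constructor
        · rintro ⟨⟨hu, -⟩, hg⟩
          refine ⟨hu, fun j hj => ?_⟩
          have h1 : f u = f u₀ := congrArg Prod.fst hg
          have h2 := congrFun (congrArg Prod.snd hg) j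
          simpa only [g, h1, hj, if_true] using h2
        · rintro ⟨hu, hag⟩
          have h1 : f u = f u₀ := hf u₀ u fun j hj => (hag j hj).symm
          refine ⟨⟨hu, by rwa [h1]⟩, ?_⟩
          simp only [g, h1, Prod.mk.injEq, true_and]
          ext j
          by_cases hj : j ∈ f u₀
          · simp [hj, hag j hj]
          · simp [hj]
      rw [e, e]
      exact hH.card_restriction_eq hm (f u₀) (not_lt.1 hu₀) u₀
    · have e : ∀ b, (((H b).filter fun u => ¬ ζ * n < ((f u).card : ℝ)).filter
          fun u => g u = p) = ∅ := by
        intro b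
        refine Finset.filter_eq_empty_iff.2 fun u hu hg => hex ⟨u, (Finset.mem_filter.1 hu).2, hg⟩
      rw [e, e]
  have h1 := hH.three_mul_card false
  have h2 := hH.three_mul_card true
  have h3 := Finset.card_filter_add_card_filter_not (s := H false)
    (fun u => ζ * n < ((f u).card : ℝ))
  have h4 := Finset.card_filter_add_card_filter_not (s := H true)
    (fun u => ζ * n < ((f u).card : ℝ))
  omega

end IsSecretSharingEnsemble

/-! ### The mixture distribution -/

/-- The weights of the mixture, in the proportion `1 - μ` to `μ`, of the uniform distributions over
`H(0)` and `H(1)`. -/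
noncomputable def mixtureWeight {n : ℕ} (H : Bool → Finset (BitStr n)) (μ : ℝ) (u : BitStr n) : ℝ :=
  (if u ∈ H false then (1 - μ) / (H false).card else 0)
    + (if u ∈ H true then μ / (H true).card else 0)

theorem mixtureWeight_nonneg {n : ℕ} {H : Bool → Finset (BitStr n)} {μ : ℝ} (h0 : 0 ≤ μ)
    (h1 : μ ≤ 1) (u : BitStr n) : 0 ≤ mixtureWeight H μ u := by
  have : 0 ≤ 1 - μ := by linarith
  unfold mixtureWeight
  split_ifs <;> positivity

/-- Turns weighted probabilities into counts in the two halves, the form in which `card_adaptive_eq`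
applies. -/
theorem sum_mixtureWeight_filter {n : ℕ} (H : Bool → Finset (BitStr n)) (μ : ℝ)
    (p : BitStr n → Prop) [DecidablePred p] :
    ∑ u, mixtureWeight H μ u * (if p u then 1 else 0)
      = (1 - μ) / (H false).card * ((H false).filter p).card
        + μ / (H true).card * ((H true).filter p).card := by
  have h : ∀ (C : Finset (BitStr n)) (c : ℝ),
      ∑ u, (if u ∈ C then c else 0) * (if p u then 1 else 0) = c * (C.filter p).card := by
    intro C c
    rw [Finset.card_filter, Nat.cast_sum, Finset.mul_sum]
    rw [← Finset.sum_subset (Finset.subset_univ C) fun u _ hu => by simp [hu]]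
    refine Finset.sum_congr rfl fun u hu => ?_
    simp [hu]
  simp only [mixtureWeight, add_mul, Finset.sum_add_distrib, h]

theorem sum_mixtureWeight {n : ℕ} {H : Bool → Finset (BitStr n)} {μ : ℝ}
    (hH : ∀ b, (H b).Nonempty) : ∑ u, mixtureWeight H μ u = 1 := by
  have h := sum_mixtureWeight_filter H μ fun _ => True
  simp only [if_true, mul_one, Finset.filter_true] at h
  have h0 : ((H false).card : ℝ) ≠ 0 := by exact_mod_cast (hH false).card_pos.ne'
  have h1 : ((H true).card : ℝ) ≠ 0 := by exact_mod_cast (hH true).card_pos.ne'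
  rw [h, div_mul_cancel₀ _ h0, div_mul_cancel₀ _ h1]
  ring

/-- The mixture, in the proportion `1 - μ` to `μ`, of the uniform distributions over `H(0)` and
`H(1)`. -/
noncomputable def mixturePMF {n : ℕ} (H : Bool → Finset (BitStr n)) (μ : ℝ)
    (hH : ∀ b, (H b).Nonempty) (h0 : 0 ≤ μ) (h1 : μ ≤ 1) : PMF (BitStr n) :=
  PMF.ofFintype (fun u => ENNReal.ofReal (mixtureWeight H μ u)) (by
    rw [← ENNReal.ofReal_sum_of_nonneg fun u _ => mixtureWeight_nonneg h0 h1 u,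
      sum_mixtureWeight hH, ENNReal.ofReal_one])

theorem mixturePMF_apply {n : ℕ} {H : Bool → Finset (BitStr n)} {μ : ℝ}
    (hH : ∀ b, (H b).Nonempty) (h0 : 0 ≤ μ) (h1 : μ ≤ 1) (u : BitStr n) :
    mixturePMF H μ hH h0 h1 u = ENNReal.ofReal (mixtureWeight H μ u) := rfl

/-- Resampling one coordinate does not affect sums over all vectors. -/
theorem sum_sum_update {ι α : Type*} [Fintype ι] [DecidableEq ι] [Fintype α] (i : ι)
    (F : (ι → α) → ℝ) :
    ∑ x, ∑ u, F (Function.update x i u) = Fintype.card α * ∑ x, F x := by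
  let σ : (ι → α) × α → (ι → α) × α := fun p => (Function.update p.1 i p.2, p.1 i)
  have hσ : Function.Involutive σ := by
    rintro ⟨x, u⟩
    simp [σ]
  have h := Equiv.sum_comp hσ.toPerm fun p : (ι → α) × α => F p.1
  rw [Fintype.sum_prod_type, Fintype.sum_prod_type] at h
  simp only [Function.Involutive.coe_toPerm, σ] at h
  rw [h, Finset.mul_sum]
  simp

open Classical in
/-- Whether the sample `i` gets many queries is independent of which part of the ensemble it comes
from. -/
theorem sum_many_queries_eq {δ ζ μ : ℝ} {m n s : ℕ} {H : Bool → Finset (BitStr n)}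
    (hH : IsSecretSharingEnsemble δ ζ m n H) (hm : 0 < m) (T : DecisionTree s n) (i : Fin s) :
    ∑ x : Fin s → BitStr n, (∏ k, mixtureWeight H μ (x k)) *
        (if x i ∈ H true ∧ ζ * n < ((indicesOf (T.queries x) i).card : ℝ) then 1 else 0)
      = μ * ∑ x : Fin s → BitStr n, (∏ k, mixtureWeight H μ (x k)) *
        (if ζ * n < ((indicesOf (T.queries x) i).card : ℝ) then 1 else 0) := by
  have hcard : (Fintype.card (BitStr n) : ℝ) ≠ 0 := by
    exact_mod_cast Fintype.card_ne_zero
  refine mul_left_cancel₀ hcard ?_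
  -- Sample `i` is resampled with all others fixed, so that its queried index set depends adaptively
  -- on its own bits only.
  rw [← sum_sum_update i, mul_left_comm, ← sum_sum_update i, Finset.mul_sum]
  refine Finset.sum_congr rfl fun x _ => ?_
  set f : BitStr n → Finset (Fin n) := fun u =>
    indicesOf (T.queries (Function.update x i u)) i with hf
  have hself : ∀ u u', (∀ j ∈ f u, u j = u' j) → f u' = f u := by
    intro u u' h
    simp only [hf]
    rw [T.queries_congr (x := Function.update x i u) (y := Function.update x i u')]
    rintro ⟨k, j⟩ hp
    by_cases hk : k = i
    · subst hk
      simpa using h j (mem_indicesOf.2 hp)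
    · simp [hk]
  have hprod : ∀ u, ∏ k, mixtureWeight H μ (Function.update x i u k)
      = mixtureWeight H μ u * ∏ k ∈ Finset.univ.erase i, mixtureWeight H μ (x k) := by
    intro u
    rw [← Finset.mul_prod_erase Finset.univ _ (Finset.mem_univ i)]
    congr 1
    · simp
    · refine Finset.prod_congr rfl fun k hk => ?_
      rw [Function.update_of_ne (Finset.ne_of_mem_erase hk)]
  have key : ∑ u, mixtureWeight H μ u *
        (if u ∈ H true ∧ ζ * n < ((f u).card : ℝ) then 1 else 0)
      = μ * ∑ u, mixtureWeight H μ u * (if ζ * n < ((f u).card : ℝ) then 1 else 0) := by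
    rw [sum_mixtureWeight_filter, sum_mixtureWeight_filter, hH.card_adaptive_eq hm f hself]
    have h1 : ((H false).filter fun u => u ∈ H true ∧ ζ * n < ((f u).card : ℝ)) = ∅ :=
      Finset.filter_eq_empty_iff.2 fun u hu h => Finset.disjoint_left.1 hH.disjoint hu h.1
    have h2 : ((H true).filter fun u => u ∈ H true ∧ ζ * n < ((f u).card : ℝ))
        = (H true).filter fun u => ζ * n < ((f u).card : ℝ) :=
      Finset.filter_congr fun u hu => by simp [hu]
    have h3 : (H false).card = (H true).card := by
      have h1 := hH.three_mul_card false
      have h2 := hH.three_mul_card true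
      omega
    rw [h1, h2, h3, Finset.card_empty]
    push_cast
    ring
  simp only [hprod, Function.update_self]
  calc _ = (∏ k ∈ Finset.univ.erase i, mixtureWeight H μ (x k)) *
        ∑ u, mixtureWeight H μ u *
          (if u ∈ H true ∧ ζ * n < ((f u).card : ℝ) then 1 else 0) := by
        rw [Finset.mul_sum]
        refine Finset.sum_congr rfl fun u _ => ?_
        ring
    _ = _ := by
        rw [key, mul_left_comm, Finset.mul_sum]
        congr 1
        refine Finset.sum_congr rfl fun u _ => ?_
        ring

open Classical in
/-- A witness needs many queries to each of many samples from `H(1)`. -/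
theorem card_lt_of_isWitness {δ ζ μ : ℝ} {a n s : ℕ} {H : Bool → Finset (BitStr n)}
    (hH : IsSecretSharingEnsemble δ ζ (3 * a) n H) (ha : 0 < a)
    (hne : ∀ b, (H b).Nonempty) (h0 : 0 ≤ μ) (h1 : μ ≤ 1)
    (x : Fin s → BitStr n) (Q : Finset (Fin s × Fin n))
    (hw : IsWitness (mixturePMF H μ hne h0 h1) (3 * a) x Q) :
    a < (Finset.univ.filter fun i =>
      x i ∈ H true ∧ ζ * n < ((indicesOf Q i).card : ℝ)).card := by
  by_contra! hle
  -- If the heavy samples from `H(1)` numbered at most `a`, they would get private colors, and the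
  -- `2 * a` words of `H(0)` would color the rest.
  refine hw.2.2 (contradictionGraph_colorable x Q _ (H false) hle (b := 2 * a) ?_ (by omega) ?_)
  · have := hH.three_mul_card false
    omega
  · intro i hi
    by_cases hf : x i ∈ H false
    · exact ⟨x i, hf, fun _ _ => rfl⟩
    have ht : x i ∈ H true := by
      by_contra ht
      have := hw.2.1 i
      rw [PMF.mem_support_iff, mixturePMF_apply] at this
      simp [mixtureWeight, hf, ht] at this
    have hlight : ((indicesOf Q i).card : ℝ) ≤ ζ * n := by
      by_contra! h
      exact hi (Finset.mem_filter.2 ⟨Finset.mem_univ _, ht, h⟩)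
    have hcard := hH.card_restriction_eq (by omega) (indicesOf Q i) hlight (x i)
    have hpos : 0 < ((H true).filter fun u => ∀ j ∈ indicesOf Q i, u j = x i j).card :=
      Finset.card_pos.2 ⟨x i, Finset.mem_filter.2 ⟨ht, fun _ _ => rfl⟩⟩
    rw [← hcard] at hpos
    obtain ⟨u, hu⟩ := Finset.card_pos.1 hpos
    exact ⟨u, (Finset.mem_filter.1 hu).1, fun j hj => ((Finset.mem_filter.1 hu).2 j hj).symm⟩

/-- A decision tree of small height is unlikely to find a witness. -/
theorem witnessProb_mixturePMF_le {δ ζ μ : ℝ} {a n s : ℕ} {H : Bool → Finset (BitStr n)}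
    (hH : IsSecretSharingEnsemble δ ζ (3 * a) n H) (ha : 0 < a) (hζn : 0 < ζ * n)
    (hne : ∀ b, (H b).Nonempty) (h0 : 0 ≤ μ) (h1 : μ ≤ 1) (T : DecisionTree s n) {B : ℝ}
    (hB : (T.height : ℝ) ≤ B) :
    T.witnessProb (mixturePMF H μ hne h0 h1) (3 * a)
      ≤ ENNReal.ofReal (μ * B / (ζ * n) / a) := by
  classical
  set P := mixturePMF H μ hne h0 h1 with hP
  have ha' : (0 : ℝ) < a := by exact_mod_cast ha
  set W : (Fin s → BitStr n) → ℝ := fun x => ∏ k, mixtureWeight H μ (x k) with hW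
  have hW0 : ∀ x, 0 ≤ W x := fun x => Finset.prod_nonneg fun k _ => mixtureWeight_nonneg h0 h1 _
  have hW1 : ∑ x, W x = 1 := by
    have := Fintype.sum_pow (mixtureWeight H μ) s
    rw [sum_mixtureWeight hne, one_pow] at this
    exact this.symm
  have heq : T.witnessProb P (3 * a) = ENNReal.ofReal
      (∑ x, if IsWitness P (3 * a) x (T.queries x) then W x else 0) := by
    rw [ENNReal.ofReal_sum_of_nonneg fun x _ => by split_ifs <;> simp [hW0 x]]
    unfold DecisionTree.witnessProb
    refine Finset.sum_congr rfl fun x _ => ?_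
    split_ifs
    · rw [hW, ENNReal.ofReal_prod_of_nonneg fun k _ => mixtureWeight_nonneg h0 h1 _]
      rfl
    · simp
  rw [heq]
  refine ENNReal.ofReal_le_ofReal ?_
  -- Markov's inequality for the number of heavily queried samples from `H(1)`.
  rw [le_div_iff₀ ha', Finset.sum_mul]
  calc ∑ x, (if IsWitness P (3 * a) x (T.queries x) then W x else 0) * a
      ≤ ∑ x, W x * ∑ i, (if x i ∈ H true ∧
          ζ * n < ((indicesOf (T.queries x) i).card : ℝ) then (1 : ℝ) else 0) := by
        refine Finset.sum_le_sum fun x _ => ?_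
        have hnn : (0 : ℝ) ≤ ∑ i, (if x i ∈ H true ∧
          ζ * n < ((indicesOf (T.queries x) i).card : ℝ) then (1 : ℝ) else 0) :=
          Finset.sum_nonneg fun i _ => by split_ifs <;> norm_num
        split_ifs with hw
        · refine mul_le_mul_of_nonneg_left ?_ (hW0 x)
          have := card_lt_of_isWitness hH ha hne h0 h1 x _ hw
          rw [← Finset.natCast_card_filter]
          exact_mod_cast this.le
        · rw [zero_mul]
          exact mul_nonneg (hW0 x) hnn
    _ = μ * ∑ x, W x * ∑ i, (if ζ * n < ((indicesOf (T.queries x) i).card : ℝ)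
          then (1 : ℝ) else 0) := by
        simp only [Finset.mul_sum (Finset.univ : Finset (Fin s))]
        rw [Finset.sum_comm, Finset.sum_congr rfl fun i _ => sum_many_queries_eq hH (by omega) T i,
          ← Finset.mul_sum, Finset.sum_comm]
    _ ≤ μ * ∑ x, W x * (B / (ζ * n)) := by
        refine mul_le_mul_of_nonneg_left (Finset.sum_le_sum fun x _ =>
          mul_le_mul_of_nonneg_left ?_ (hW0 x)) h0
        rw [le_div_iff₀ hζn, ← Finset.natCast_card_filter]
        refine le_trans ?_ ((card_filter_indicesOf_mul_le (T.queries x) (ζ * n)).trans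
          (le_trans (by exact_mod_cast T.card_queries_le x) hB))
        refine mul_le_mul_of_nonneg_right ?_ hζn.le
        exact_mod_cast Finset.card_le_card fun i hi => Finset.mem_filter.2
          ⟨Finset.mem_univ _, le_of_lt (Finset.mem_filter.1 hi).2⟩
    _ = μ * B / (ζ * n) := by rw [← Finset.sum_mul, hW1]; ring

/-- The mixture is far from being supported on `m` strings. -/
theorem isFar_mixturePMF {δ ζ μ ε : ℝ} {a n : ℕ} {H : Bool → Finset (BitStr n)}
    (hH : IsSecretSharingEnsemble δ ζ (3 * a) n H) (ha : 0 < a)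
    (hne : ∀ b, (H b).Nonempty) (h0 : 0 < μ) (h1 : μ ≤ 1) (h2 : μ ≤ 1 / 2)
    (hε0 : 0 < ε) (hε : ε < μ / 2 * (δ / 2)) :
    IsFar ε (mixturePMF H μ hne h0.le h1) (boundedSupport n (3 * a)) := by
  classical
  refine isFar_boundedSupport (by positivity) hε hε0 fun S hS => ?_
  have ha' : (0 : ℝ) < a := by exact_mod_cast ha
  have hc : ∀ b, (H b).card = 2 * a := fun b => by have := hH.three_mul_card b; omega
  set F := Finset.univ.filter fun u : BitStr n => ∀ v ∈ S, δ / 2 ≤ strDist u v with hF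
  set U := H false ∪ H true with hU
  have hUc : U.card = 4 * a := by
    rw [hU, Finset.card_union_of_disjoint hH.disjoint, hc, hc]; omega
  -- No string of `S` is `δ / 2`-close to two codewords, so choosing a close string is injective.
  have hcov : (U.filter fun u => u ∉ F).card ≤ 3 * a := by
    refine le_trans ?_ hS
    have hex : ∀ u ∈ U.filter fun u => u ∉ F, ∃ v ∈ S, strDist u v < δ / 2 := by
      intro u hu
      have h := (Finset.mem_filter.1 hu).2
      simp only [hF, Finset.mem_filter, Finset.mem_univ, true_and] at h
      push Not at h
      exact h
    choose! g hgS hg using hex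
    refine Finset.card_le_card_of_injOn g hgS fun u hu u' hu' h => ?_
    refine (hH.dist_lt u (Finset.mem_filter.1 hu).1 u' (Finset.mem_filter.1 hu').1).resolve_right ?_
    have e1 := hg u hu
    have e2 := hg u' hu'
    rw [← h] at e2
    have e3 : strDist u u' ≤ strDist u (g u) + strDist u' (g u) := by
      unfold strDist
      rw [← add_div]
      gcongr
      exact_mod_cast hammingDist_triangle_right u u' (g u)
    linarith
  have htot := Finset.card_filter_add_card_filter_not (s := U) (fun u => u ∈ F)
  have hUF : a ≤ (U.filter fun u => u ∈ F).card := by omega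
  -- Since `μ ≤ 1 / 2`, the words of `H(1)` are the lightest.
  have hweight : ∀ u ∈ U, μ / (2 * a) ≤ mixtureWeight H μ u := by
    intro u hu
    have hc' : ∀ b, ((H b).card : ℝ) = 2 * a := fun b => by exact_mod_cast hc b
    have hnn : μ / (2 * a) ≤ (1 - μ) / (2 * a) := by gcongr; linarith
    have hp : 0 ≤ μ / (2 * a) := by positivity
    unfold mixtureWeight
    rw [hc', hc']
    rcases Finset.mem_union.1 hu with h | h
    · rw [if_pos h]; split_ifs <;> linarith
    · rw [if_pos h]; split_ifs <;> linarith
  simp only [mixturePMF_apply]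
  rw [← ENNReal.ofReal_sum_of_nonneg fun u _ => mixtureWeight_nonneg h0.le h1 u]
  refine ENNReal.ofReal_le_ofReal ?_
  calc μ / 2 = a * (μ / (2 * a)) := by field_simp
    _ ≤ (U.filter fun u => u ∈ F).card * (μ / (2 * a)) := by
        gcongr
    _ = ∑ u ∈ U.filter fun u => u ∈ F, μ / (2 * a) := by rw [Finset.sum_const, nsmul_eq_mul]
    _ ≤ ∑ u ∈ U.filter fun u => u ∈ F, mixtureWeight H μ u :=
        Finset.sum_le_sum fun u hu => hweight u (Finset.mem_filter.1 hu).1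
    _ ≤ ∑ u ∈ F, mixtureWeight H μ u :=
        Finset.sum_le_sum_of_subset_of_nonneg (fun u hu => (Finset.mem_filter.1 hu).2)
          fun u _ _ => mixtureWeight_nonneg h0.le h1 u

/-- A randomized algorithm is not better than the deterministic ones that it is made of. -/
theorem AdaptiveAlgorithm.witnessProb_le {s n m : ℕ} {P : PMF (BitStr n)}
    (A : AdaptiveAlgorithm s n) {c : ℝ≥0∞}
    (h : ∀ T ∈ PMF.support A, T.witnessProb P m ≤ c) : A.witnessProb P m ≤ c := by
  unfold AdaptiveAlgorithm.witnessProb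
  calc ∑' T : DecisionTree s n, (A : PMF (DecisionTree s n)) T * T.witnessProb P m
      ≤ ∑' T : DecisionTree s n, (A : PMF (DecisionTree s n)) T * c := by
        refine ENNReal.tsum_le_tsum fun T => ?_
        by_cases h0 : (A : PMF (DecisionTree s n)) T = 0
        · simp [h0]
        · gcongr
          exact h T h0
    _ = c := by rw [ENNReal.tsum_mul_right, PMF.tsum_coe, one_mul]

/-! ### Consequences for the parameters, and the two ranges of `ε` -/

namespace IsSecretSharingEnsemble

variable {δ ζ : ℝ} {m n : ℕ} {H : Bool → Finset (BitStr n)}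

theorem three_mul_card_union (hH : IsSecretSharingEnsemble δ ζ m n H) :
    3 * (H false ∪ H true).card = 4 * m := by
  rw [Finset.card_union_of_disjoint hH.disjoint]
  have h1 := hH.three_mul_card false
  have h2 := hH.three_mul_card true
  omega

theorem logb_le (hH : IsSecretSharingEnsemble δ ζ m n H) (hm : 0 < m) :
    Real.logb 2 m ≤ n := by
  have h1 : (H false ∪ H true).card ≤ 2 ^ n := (Finset.card_le_univ _).trans_eq (by simp)
  have h2 := hH.three_mul_card_union
  rw [Real.logb_le_iff_le_rpow (by norm_num) (by exact_mod_cast hm), Real.rpow_natCast]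
  exact_mod_cast (show m ≤ 2 ^ n by omega)

theorem delta_lt_one (hH : IsSecretSharingEnsemble δ ζ m n H) (hm : 2 ≤ m) : δ < 1 := by
  have h2 := hH.three_mul_card false
  obtain ⟨u, hu, v, hv, huv⟩ := Finset.one_lt_card.1 (show 1 < (H false).card by omega)
  refine ((hH.dist_lt u (Finset.mem_union_left _ hu) v
    (Finset.mem_union_left _ hv)).resolve_left huv).trans_le ?_
  refine div_le_one_of_le₀ ?_ (by positivity)
  have := hammingDist_le_card_fintype (x := u) (y := v)
  rw [Fintype.card_fin] at this
  exact_mod_cast this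

/-- Otherwise sharing would apply to all indices at once and put a word of `H(1)` into `H(0)`. -/
theorem zeta_lt_one (hH : IsSecretSharingEnsemble δ ζ m n H) (hm : 2 ≤ m) : ζ < 1 := by
  by_contra! h
  have h2 := hH.three_mul_card true
  obtain ⟨w, hw⟩ := Finset.card_pos.1 (show 0 < (H true).card by omega)
  have hcard := hH.card_restriction_eq (by omega) Finset.univ (by
    rw [Finset.card_univ, Fintype.card_fin]
    exact le_mul_of_one_le_left (by positivity) h) w
  have hpos : 0 < ((H true).filter fun u => ∀ j ∈ Finset.univ, u j = w j).card :=
    Finset.card_pos.2 ⟨w, Finset.mem_filter.2 ⟨hw, fun _ _ => rfl⟩⟩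
  rw [← hcard] at hpos
  obtain ⟨u, hu⟩ := Finset.card_pos.1 hpos
  have huw : u = w := funext fun j => (Finset.mem_filter.1 hu).2 j (Finset.mem_univ j)
  exact Finset.disjoint_left.1 hH.disjoint (huw ▸ (Finset.mem_filter.1 hu).1) hw

/-- The lower bound for small `ε`, by the mixture distribution. -/
theorem exists_far_of_small {ε : ℝ} (hH : IsSecretSharingEnsemble δ ζ m n H) (h3 : 3 ∣ m)
    (hm : 2 ≤ m) (hδ : 0 < δ) (hζ : 0 < ζ) (hε : 0 < ε) (hεδ : ε < 1 / 16 * δ) :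
    ∃ P : PMF (BitStr n), IsFar ε P (boundedSupport n m) ∧
      ∀ (s : ℕ) (A : AdaptiveAlgorithm s n),
        AdaptiveAlgorithm.MakesFewerQueriesThan A
          (1 / 96 * ζ * δ * ε⁻¹ * m * Real.logb 2 m) →
        AdaptiveAlgorithm.witnessProb A P m < 1 / 3 := by
  obtain ⟨a, rfl⟩ := h3
  have ha : 0 < a := by omega
  have ha' : (0 : ℝ) < a := by exact_mod_cast ha
  have hne : ∀ b, (H b).Nonempty := fun b => Finset.card_pos.1 (by
    have := hH.three_mul_card b; omega)
  have hlog := hH.logb_le (by omega)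
  have hlog0 : 0 < Real.logb 2 (3 * a : ℕ) :=
    Real.logb_pos (by norm_num) (by exact_mod_cast (show 1 < 3 * a by omega))
  have hn : (0 : ℝ) < n := hlog0.trans_le hlog
  -- The farness bound `μ * δ / 4` becomes `2 * ε`, and `ε < δ / 16` is what keeps `μ` below `1 /
  -- 2`.
  set μ := 8 * ε / δ with hμ
  have hμ0 : 0 < μ := by positivity
  have hμ2 : μ ≤ 1 / 2 := by rw [hμ, div_le_iff₀ hδ]; linarith
  have hμ1 : μ ≤ 1 := by linarith
  refine ⟨mixturePMF H μ hne hμ0.le hμ1, isFar_mixturePMF hH ha hne hμ0 hμ1 hμ2 hε ?_, ?_⟩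
  · have : μ / 2 * (δ / 2) = 2 * ε := by rw [hμ]; field_simp; norm_num
    linarith
  · intro s A hA
    refine (AdaptiveAlgorithm.witnessProb_le A fun T hT => witnessProb_mixturePMF_le hH ha
      (by positivity) hne hμ0.le hμ1 T (hA T hT).le).trans_lt ?_
    rw [show (1 / 3 : ℝ≥0∞) = ENNReal.ofReal (1 / 3) by
      rw [ENNReal.ofReal_div_of_pos (by norm_num)]; simp]
    refine (ENNReal.ofReal_lt_ofReal_iff (by norm_num)).2 ?_
    -- The constant `1 / 96` makes the Markov bound at most `8 * 3 / 96 = 1 / 4`.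
    have h : μ * (1 / 96 * ζ * δ * ε⁻¹ * (3 * a : ℕ) * Real.logb 2 (3 * a : ℕ)) / (ζ * n) / a
        = 1 / 4 * (Real.logb 2 (3 * a : ℕ) / n) := by
      rw [hμ, Nat.cast_mul]
      field_simp
      norm_num
      ring
    rw [h]
    have : Real.logb 2 (3 * a : ℕ) / n ≤ 1 := div_le_one_of_le₀ hlog hn.le
    linarith

/-- The lower bound for large `ε`, by the uniform distribution. -/
theorem exists_far_of_large {ε : ℝ} (hH : IsSecretSharingEnsemble δ ζ m n H) (h3 : 3 ∣ m)
    (hm : 1400 ≤ m) (hn : 66 ≤ n) (hδn : 40 ≤ δ * n) (hδ : 0 < δ) (hε : 0 < ε)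
    (hεδ : 1 / 16 * δ ≤ ε) (hεδ' : ε < 1 / 4 * δ) :
    ∃ P : PMF (BitStr n), IsFar ε P (boundedSupport n m) ∧
      ∀ (s : ℕ) (A : AdaptiveAlgorithm s n),
        AdaptiveAlgorithm.MakesFewerQueriesThan A
          (1 / 96 * ζ * δ * ε⁻¹ * m * Real.logb 2 m) →
        AdaptiveAlgorithm.witnessProb A P m < 1 / 3 := by
  refine ⟨PMF.uniformOfFintype (BitStr n), isFar_uniformOfFintype (H false ∪ H true) hH.dist_lt
    hH.three_mul_card_union.ge hδ (hH.delta_lt_one (by omega)) hn hδn hε hεδ', ?_⟩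
  intro s A hA
  have hlog0 : 0 < Real.logb 2 m :=
    Real.logb_pos (by norm_num) (by exact_mod_cast (show 1 < m by omega))
  -- Here `ζ < 1` and `δ / ε ≤ 16`, and `16 / 96 = 1 / 6`.
  have hbound : 1 / 96 * ζ * δ * ε⁻¹ * m * Real.logb 2 m ≤ 1 / 6 * m * Real.logb 2 m := by
    have h1 : δ * ε⁻¹ ≤ 16 := by
      rw [← div_eq_mul_inv, div_le_iff₀ hε]; linarith
    have h2 : ζ * (δ * ε⁻¹) ≤ 1 * 16 :=
      mul_le_mul (hH.zeta_lt_one (by omega)).le h1 (by positivity) (by norm_num)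
    have h3 : 1 / 96 * ζ * δ * ε⁻¹ ≤ 1 / 6 := by linarith
    gcongr
  refine (AdaptiveAlgorithm.witnessProb_le A (c := 0) fun T hT => ?_).trans_lt (by simp)
  unfold DecisionTree.witnessProb
  refine (Finset.sum_eq_zero fun x _ => if_neg fun hw => hw.2.2 ?_).le
  refine contradictionGraph_colorable_of_card_le x _ h3 hm ?_
  calc ((T.queries x).card : ℝ) ≤ T.height := by exact_mod_cast T.card_queries_le x
    _ ≤ _ := (hA T hT).le.trans hbound

end IsSecretSharingEnsemble

theorem mainTheorem4 :
    (∃ δ ζ η : ℝ, AreSecretSharingConstants δ ζ η) ∧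
    ∀ δ ζ η : ℝ, AreSecretSharingConstants δ ζ η →
      ∀ k : ℕ, 1 ≤ k → ∃ m n : ℕ, 2 * k ≤ m ∧ (n : ℝ) ≤ η * Real.logb 2 m ∧
        ∀ ε : ℝ, 0 < ε → ε < 1 / 4 * δ →
          ∃ P : PMF (BitStr n), IsFar ε P (boundedSupport n m) ∧
            ∀ (s : ℕ) (A : AdaptiveAlgorithm s n),
              AdaptiveAlgorithm.MakesFewerQueriesThan A
                (1 / 96 * ζ * δ * ε⁻¹ * m * Real.logb 2 m) →
              AdaptiveAlgorithm.witnessProb A P m < 1 / 3 := by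
  refine ⟨exists_areSecretSharingConstants, fun δ ζ η hc k hk => ?_⟩
  have hδ := hc.delta_pos
  set N := max 66 ⌈40 / δ⌉₊ with hN
  have hN0 : 0 < 2 ^ N := by positivity
  -- The ensemble size is doubled in `m`: 700 yields `m ≥ 1400`, and `2 ^ N ≤ m` forces `N ≤ log₂ m
  -- ≤ n`, hence `n ≥ 66` and `δ * n ≥ 40`.
  obtain ⟨m, n, hm, h3, hn, H, hH⟩ := hc.exists_ensemble (k + 700 + 2 ^ N) (by omega)
  have hNn : N ≤ n := by
    have h1 : ((N : ℕ) : ℝ) ≤ Real.logb 2 m := by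
      rw [Real.le_logb_iff_rpow_le (by norm_num) (by exact_mod_cast (show 0 < m by omega)),
        Real.rpow_natCast]
      exact_mod_cast (show 2 ^ N ≤ m by omega)
    exact_mod_cast h1.trans (hH.logb_le (by omega))
  refine ⟨m, n, by omega, hn, fun ε hε hεδ => ?_⟩
  rcases lt_or_ge ε (1 / 16 * δ) with h | h
  · exact hH.exists_far_of_small h3 (by omega) hδ hc.zeta_pos hε h
  · refine hH.exists_far_of_large h3 (by omega) ((le_max_left _ _).trans hNn) ?_ hδ hε h hεδ
    have h1 : 40 / δ ≤ n := (Nat.le_ceil _).trans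
      (by exact_mod_cast (le_max_right 66 _).trans hNn)
    rwa [div_le_iff₀' hδ] at h1
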